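/- A touching-triangle representation of a graph $G=(V,E)$ assigns to every vertex a nondegenerate triangle in the plane such that triangles of distinct vertices have disjoint interiors, and the triangles of two distinct vertices $u,v$ touch non-trivially (a side of one and a side of the other overlap in more than a single point) if and only if $uv\in E$. Contacts in single points do not count as adjacencies, and holes between the triangles are allowed. The square grid is the graph on $\mathbb Z^2$ in which points at distance $1$ are adjacent; the hexagonal grid is the graph formed by the vertices and edges of the tiling of the plane by regular hexagons. Theorem. Every finite subgraph of the square grid or of the hexagonal grid has a touching-triangle representation. Moreover, for each of the two grids there is an algorithm that, given such a subgraph $G=(V,E)$ (the list of its vertices, each with the integer coordinates of its grid point, and the list of its edges), computes a touching-triangle representation of $G$ in time $O(|V|+|E|+1)$. Time is counted as the number of unit-cost steps on a random access machine with words of $O(\log M)$ bits, where $M \geq 2$ bounds the length of the input and the absolute values of the integers in it. -/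

import Mathlib

namespace TouchingTriangles

/-! ### Touching-triangle representations -/

/-- The Euclidean plane. -/
abbrev Plane : Type := EuclideanSpace ℝ (Fin 2)

/-- Two triangles touch non-trivially: some side of the first and some side of the second
overlap in more than a single point. -/
def SidesTouch (S T : Affine.Triangle ℝ Plane) : Prop :=
  ∃ i j k l : Fin 3, i ≠ j ∧ k ≠ l ∧
    (segment ℝ (S.points i) (S.points j) ∩ segment ℝ (T.points k) (T.points l)).Nontrivial

/-- A touching-triangle representation of `G`: every vertex is assigned a (nondegenerate) triangle
of the plane, triangles of distinct vertices have disjoint interiors (so they are distinct), and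
two of them touch along their sides if and only if the vertices are adjacent. Touching in single
points is allowed and is not an adjacency; holes between the triangles are allowed. -/
def IsTTRep {V : Type*} (G : SimpleGraph V) (T : V → Affine.Triangle ℝ Plane) : Prop :=
  ∀ u v : V, u ≠ v →
    Disjoint (T u).interior (T v).interior ∧ (G.Adj u v ↔ SidesTouch (T u) (T v))

/-! ### The two infinite grids -/

/-- The square grid: points of `ℤ × ℤ`, adjacent at distance one. -/
def squareGrid : SimpleGraph (ℤ × ℤ) where
  Adj p q := |p.1 - q.1| + |p.2 - q.2| = 1
  symm := ⟨fun p q h => by rwa [abs_sub_comm p.1, abs_sub_comm p.2] at h⟩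
  loopless := ⟨fun p h => by simp at h⟩

/-- `(a, b, false)` is joined to `(a, b, true)`, `(a - 1, b, true)` and `(a, b - 1, true)`. -/
def HexStep (p q : ℤ × ℤ × Bool) : Prop :=
  p.2.2 = false ∧ q.2.2 = true ∧
    ((q.1 = p.1 ∧ q.2.1 = p.2.1) ∨ (q.1 = p.1 - 1 ∧ q.2.1 = p.2.1) ∨
      (q.1 = p.1 ∧ q.2.1 = p.2.1 - 1))

/-- The hexagonal grid (the vertices and edges of the tiling of the plane by regular hexagons).
With lattice vectors `e₁`, `e₂` of equal length at an angle of 60 degrees, `(a, b, false)` is the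
point `a e₁ + b e₂` and `(a, b, true)` is the point `a e₁ + b e₂ + (e₁ + e₂) / 3`; every point is
joined to the three nearest points of the other kind. -/
def hexGrid : SimpleGraph (ℤ × ℤ × Bool) where
  Adj p q := HexStep p q ∨ HexStep q p
  symm := ⟨fun _ _ h => h.symm⟩
  loopless := ⟨fun p h => by rcases h with h | h <;> simp [HexStep] at h⟩

/-- The coordinates of a point of the square grid, as machine words. -/
def squareCode (p : ℤ × ℤ) : List ℤ := [p.1, p.2]

/-- The coordinates of a point of the hexagonal grid, as machine words. -/
def hexCode (p : ℤ × ℤ × Bool) : List ℤ := [p.1, p.2.1, if p.2.2 then 1 else 0]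

/-! ### A word random access machine with unit costs -/

/-- A configuration: registers and a random access memory, both holding integers. -/
structure Config where
  reg : ℕ → ℤ
  mem : ℤ → ℤ

/-- Overwrite a register. -/
def Config.setReg (s : Config) (r : ℕ) (x : ℤ) : Config :=
  { s with reg := Function.update s.reg r x }

/-- Overwrite a memory cell. -/
def Config.setMem (s : Config) (a x : ℤ) : Config :=
  { s with mem := Function.update s.mem a x }

/-- Structured programs of the random access machine. -/
inductive Program : Type
  /-- `reg r := x` -/
  | const (r : ℕ) (x : ℤ)
  /-- `reg r := reg a + reg b` -/
  | add (r a b : ℕ)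
  /-- `reg r := reg a - reg b` -/
  | sub (r a b : ℕ)
  /-- `reg r := reg a * reg b` -/
  | mul (r a b : ℕ)
  /-- `reg r := mem (reg a)` -/
  | load (r a : ℕ)
  /-- `mem (reg a) := reg b` -/
  | store (a b : ℕ)
  /-- first `p`, then `q` -/
  | seq (p q : Program)
  /-- if `reg r > 0` then `p` else `q` -/
  | ite (r : ℕ) (p q : Program)
  /-- while `reg r > 0` do `p` -/
  | loop (r : ℕ) (p : Program)

/-- `Exec W p s t s'`: started in `s`, the program `p` halts in `s'` after exactly `t` steps, on a
machine whose words hold the integers of absolute value at most `W`. Every elementary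
instruction and every test is one step. An instruction whose result does not fit into a word
cannot be executed. -/
inductive Exec (W : ℤ) : Program → Config → ℕ → Config → Prop
  | const (s : Config) (r : ℕ) (x : ℤ) (h : |x| ≤ W) :
      Exec W (.const r x) s 1 (s.setReg r x)
  | add (s : Config) (r a b : ℕ) (h : |s.reg a + s.reg b| ≤ W) :
      Exec W (.add r a b) s 1 (s.setReg r (s.reg a + s.reg b))
  | sub (s : Config) (r a b : ℕ) (h : |s.reg a - s.reg b| ≤ W) :
      Exec W (.sub r a b) s 1 (s.setReg r (s.reg a - s.reg b))
  | mul (s : Config) (r a b : ℕ) (h : |s.reg a * s.reg b| ≤ W) :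
      Exec W (.mul r a b) s 1 (s.setReg r (s.reg a * s.reg b))
  | load (s : Config) (r a : ℕ) :
      Exec W (.load r a) s 1 (s.setReg r (s.mem (s.reg a)))
  | store (s : Config) (a b : ℕ) :
      Exec W (.store a b) s 1 (s.setMem (s.reg a) (s.reg b))
  | seq {p q : Program} {s₁ s₂ s₃ : Config} {t₁ t₂ : ℕ}
      (h₁ : Exec W p s₁ t₁ s₂) (h₂ : Exec W q s₂ t₂ s₃) :
      Exec W (.seq p q) s₁ (t₁ + t₂) s₃
  | ite_pos {r : ℕ} {p q : Program} {s s' : Config} {t : ℕ}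
      (h : 0 < s.reg r) (hp : Exec W p s t s') : Exec W (.ite r p q) s (t + 1) s'
  | ite_neg {r : ℕ} {p q : Program} {s s' : Config} {t : ℕ}
      (h : s.reg r ≤ 0) (hq : Exec W q s t s') : Exec W (.ite r p q) s (t + 1) s'
  | loop_pos {r : ℕ} {p : Program} {s₁ s₂ s₃ : Config} {t₁ t₂ : ℕ}
      (h : 0 < s₁.reg r) (hp : Exec W p s₁ t₁ s₂) (hl : Exec W (.loop r p) s₂ t₂ s₃) :
      Exec W (.loop r p) s₁ (t₁ + t₂ + 1) s₃
  | loop_neg {r : ℕ} {p : Program} {s : Config}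
      (h : s.reg r ≤ 0) : Exec W (.loop r p) s 1 s

/-- The start configuration on a list of input words: the words stand in the memory cells
`0, 1, 2, …`; all other cells and all registers are zero. -/
def startConfig (input : List ℤ) : Config where
  reg := fun _ => 0
  mem := fun a => if 0 ≤ a then input.getD a.toNat 0 else 0

/-! ### Input, output and linear time -/

/-- The input words for a graph on the vertices `0, …, n - 1` placed at grid points: the number of
vertices, the number of listed edges, the coordinates of the vertices, the listed edges as
pairs of vertex numbers. -/
def inputWords {P : Type*} (code : P → List ℤ) {n : ℕ} (pos : Fin n → P)
    (es : List (Fin n × Fin n)) : List ℤ :=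
  [(n : ℤ), (es.length : ℤ)] ++ (List.ofFn fun v => code (pos v)).flatten ++
    es.flatMap fun e => [((e.1 : ℕ) : ℤ), ((e.2 : ℕ) : ℤ)]

/-- The triangles `T` are written in the memory, beginning at the cell whose address is in
register `0`: six words for every vertex, the coordinates of the three corners. -/
def OutputsTriangles {n : ℕ} (s : Config) (T : Fin n → Affine.Triangle ℝ Plane) : Prop :=
  ∀ (v : Fin n) (i : Fin 3) (j : Fin 2),
    (T v).points i j = ((s.mem (s.reg 0 + 6 * (v : ℕ) + 2 * (i : ℕ) + (j : ℕ)) : ℤ) : ℝ)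

/-- Touching-triangle representations of finite subgraphs of the grid `L` can be computed in linear
time. A subgraph is given by an injective placement `φ` of its vertices `0, …, n - 1` at points
of `L`, mapping its edges to edges of `L`, and by a list `es` of its edges, in any order and
orientation. There are one program and constants `c`, `k` such that the program outputs a
representation after at most `c * (n + es.length + 1)` steps; words of size polynomial in
`M` suffice (that is, words of `O(log M)` bits), where `M` is any bound for the length of the
input and for its words. -/
def TTRepInLinearTime {P : Type*} (L : SimpleGraph P) (code : P → List ℤ) : Prop :=
  ∃ (p : Program) (c k : ℕ), ∀ (n : ℕ) (G : SimpleGraph (Fin n)) (φ : SimpleGraph.Copy G L)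
    (es : List (Fin n × Fin n)), (∀ u v, G.Adj u v ↔ (u, v) ∈ es ∨ (v, u) ∈ es) →
    ∀ M : ℕ, (inputWords code φ es).length ≤ M → (∀ w ∈ inputWords code φ es, |w| ≤ (M : ℤ)) →
    ∃ (t : ℕ) (s : Config) (T : Fin n → Affine.Triangle ℝ Plane),
      Exec (((M : ℤ) + 2) ^ k) p (startConfig (inputWords code φ es)) t s ∧
      t ≤ c * (n + es.length + 1) ∧ OutputsTriangles s T ∧ IsTTRep G T

end TouchingTriangles

/-! ### The triangle attached to a grid point. -/

namespace TouchingTriangles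

/-! The line `lin k = r` is the tangent, at height `2k`, of the parabola `x = y²/4 + r`. For a fixed
point, `lin k` is a quadratic in `k` whose second difference is 2; all the geometry rests on this.

The grid point `(a, b)`, with `s = a - b` and `c = a + b`, gets a triangle with base on `lin s = c +
1`, from height `2s - β` to height `2s + ε`. Its apex, at height `2s`, lies on both `lin (s - 1) =
c` and `lin (s + 1) = c`, the base lines of the neighbours `(a - 1, b)` and `(a, b - 1)`. With `β =
2` the bottom side lies along the first of these lines and overlaps the neighbour's base; with `β =
1` only the apex remains on that line. The parameter `ε` does the same for the top side and the
second neighbour. So every edge is switched on independently, at its endpoint with the larger `c`.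
Unwanted overlaps are excluded by `disjoint_interior_tri_of_le` and `contact_cases`; wanted contacts
come from `sidesTouch_bottom` and `sidesTouch_top`. The hexagonal grid embeds in the square grid as
a brick wall (`hexToSquare`), and missing edges are harmless.

For the algorithm, all triangles are written with `β = ε = 1`; then every listed edge overwrites one
corner of one triangle, in constant time (`holds_update`). All numbers stay quadratic in the input
bound, so the words suffice. -/

/-- The three corners (bottom, apex, top) of the triangle of a grid point `(a, b)` with
`s = a - b` and `c = a + b`. -/
def corner (s c β ε : ℤ) : Fin 3 → Fin 2 → ℤ :=
  ![![s * s - β * s + c + 1, 2 * s - β], ![s * s + c - 1, 2 * s],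
    ![s * s + ε * s + c + 1, 2 * s + ε]]

/-- The corners as points of the plane. -/
noncomputable def cornerPoint (s c β ε : ℤ) (i : Fin 3) : Plane :=
  !₂[(corner s c β ε i 0 : ℝ), (corner s c β ε i 1 : ℝ)]

theorem cornerPoint_apply (s c β ε : ℤ) (i : Fin 3) (j : Fin 2) :
    cornerPoint s c β ε i j = (corner s c β ε i j : ℝ) := by
  fin_cases j <;> simp [cornerPoint]

theorem affineIndependent_cornerPoint {s c β ε : ℤ} (hβ : 0 < β) (hε : 0 < ε) :
    AffineIndependent ℝ (cornerPoint s c β ε) := by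
  rw [affineIndependent_iff_of_fintype]
  intro w hw h
  rw [Finset.weightedVSub_eq_linear_combination _ hw] at h
  have h0 := congrArg (fun p : Plane => p 0) h
  have h1 := congrArg (fun p : Plane => p 1) h
  simp [Fin.sum_univ_three, cornerPoint_apply, corner] at h0 h1 hw
  have hβ' : (0 : ℝ) < β := by exact_mod_cast hβ
  have hε' : (0 : ℝ) < ε := by exact_mod_cast hε
  -- This combination is the functional `lin s`: it is `c + 1` at both ends of the base and `c - 1`
  -- at the apex, so it isolates `w 1`.
  have e1 : w 1 = 0 := by
    linear_combination (-1 / 2) * h0 + (s / 2 : ℝ) * h1 + (-(s : ℝ) ^ 2 + c + 1) / 2 * hw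
  have e2 : (ε + β : ℝ) * w 2 = 0 := by
    linear_combination h1 - (2 * s - β : ℝ) * hw - (β : ℝ) * e1
  have e3 : w 2 = 0 := by
    rcases mul_eq_zero.1 e2 with h | h
    · linarith
    · exact h
  have e4 : w 0 = 0 := by linarith
  intro i
  fin_cases i <;> assumption

/-- The triangle of a grid point. -/
noncomputable def tri (s c β ε : ℤ) (hβ : 0 < β) (hε : 0 < ε) : Affine.Triangle ℝ Plane :=
  ⟨cornerPoint s c β ε, affineIndependent_cornerPoint hβ hε⟩

/-! ### Linear inequalities bounding the triangles. -/

/-- The affine functionals bounding the triangles. -/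
def lin (k : ℤ) (p : Plane) : ℝ := p 0 - k * p 1 + k ^ 2

theorem le_lin_of_mem_segment {k : ℤ} {r : ℝ} {p q x : Plane} (hx : x ∈ segment ℝ p q)
    (hp : r ≤ lin k p) (hq : r ≤ lin k q) : r ≤ lin k x := by
  obtain ⟨a, b, ha, hb, hab, rfl⟩ := hx
  have : lin k (a • p + b • q) = a * lin k p + b * lin k q := by
    simp only [lin, PiLp.add_apply, PiLp.smul_apply, smul_eq_mul]
    linear_combination -(k : ℝ) ^ 2 * hab
  rw [this]
  have h1 := mul_le_mul_of_nonneg_left hp ha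
  have h2 := mul_le_mul_of_nonneg_left hq hb
  have h3 : r = a * r + b * r := by rw [← add_mul, hab, one_mul]
  linarith

theorem lin_le_of_mem_segment {k : ℤ} {r : ℝ} {p q x : Plane} (hx : x ∈ segment ℝ p q)
    (hp : lin k p ≤ r) (hq : lin k q ≤ r) : lin k x ≤ r := by
  obtain ⟨a, b, ha, hb, hab, rfl⟩ := hx
  have : lin k (a • p + b • q) = a * lin k p + b * lin k q := by
    simp only [lin, PiLp.add_apply, PiLp.smul_apply, smul_eq_mul]
    linear_combination -(k : ℝ) ^ 2 * hab
  rw [this]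
  have h1 := mul_le_mul_of_nonneg_left hp ha
  have h2 := mul_le_mul_of_nonneg_left hq hb
  have h3 : r = a * r + b * r := by rw [← add_mul, hab, one_mul]
  linarith

section Bounds

variable {s c β ε : ℤ}

theorem lin_cornerPoint (k : ℤ) (i : Fin 3) :
    lin k (cornerPoint s c β ε i) =
      ((corner s c β ε i 0 - k * corner s c β ε i 1 + k ^ 2 : ℤ) : ℝ) := by
  simp [lin, cornerPoint_apply]

/-- With `δ = s - k`, the values of `lin k` at bottom, apex and top are `δ² - βδ + c + 1`, `δ² + c -
1` and `δ² + εδ + c + 1`. This bound and the next four are the cases `δ = 0, ±1, ±2`. -/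
theorem lin_corner_le (i : Fin 3) : lin s (cornerPoint s c β ε i) ≤ c + 1 := by
  rw [lin_cornerPoint]
  norm_cast
  fin_cases i <;> simp [corner] <;> nlinarith

theorem le_lin_corner_sub (hβ : β ≤ 2) (hε : 0 < ε) (i : Fin 3) :
    (c : ℝ) ≤ lin (s - 1) (cornerPoint s c β ε i) := by
  rw [lin_cornerPoint]
  norm_cast
  fin_cases i <;> simp [corner] <;> nlinarith

theorem le_lin_corner_add (hβ : 0 < β) (hε : ε ≤ 2) (i : Fin 3) :
    (c : ℝ) ≤ lin (s + 1) (cornerPoint s c β ε i) := by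
  rw [lin_cornerPoint]
  norm_cast
  fin_cases i <;> simp [corner] <;> nlinarith

theorem le_lin_corner_sub_two (hβ : β ≤ 1) (hε : 0 < ε) (i : Fin 3) :
    (c + 3 : ℝ) ≤ lin (s - 2) (cornerPoint s c β ε i) := by
  rw [lin_cornerPoint]
  norm_cast
  fin_cases i <;> simp [corner] <;> nlinarith

theorem le_lin_corner_add_two (hβ : 0 < β) (hε : ε ≤ 1) (i : Fin 3) :
    (c + 3 : ℝ) ≤ lin (s + 2) (cornerPoint s c β ε i) := by
  rw [lin_cornerPoint]
  norm_cast
  fin_cases i <;> simp [corner] <;> nlinarith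

/-- In the interior all barycentric weights are positive, which makes the three bounds strict. -/
theorem lin_interior {hβ : 0 < β} {hε : 0 < ε} (hβ2 : β ≤ 2) (hε2 : ε ≤ 2) {x : Plane}
    (hx : x ∈ (tri s c β ε hβ hε).interior) :
    lin s x < c + 1 ∧ c < lin (s - 1) x ∧ c < lin (s + 1) x := by
  obtain ⟨w, hw, hI, rfl⟩ := hx
  rw [Finset.affineCombination_eq_linear_combination _ _ _ hw]
  have hI0 := (hI 0).1
  have hI1 := (hI 1).1
  have hI2 := (hI 2).1
  rw [Fin.sum_univ_three] at hw ⊢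
  have hβ' : (0 : ℝ) < β := by exact_mod_cast hβ
  have hε' : (0 : ℝ) < ε := by exact_mod_cast hε
  have hβ2' : (β : ℝ) ≤ 2 := by exact_mod_cast hβ2
  have hε2' : (ε : ℝ) ≤ 2 := by exact_mod_cast hε2
  have m1 := mul_pos hI0 hβ'
  have m2 := mul_pos hI2 hε'
  have m3 := mul_le_mul_of_nonneg_left hβ2' hI0.le
  have m4 := mul_le_mul_of_nonneg_left hε2' hI2.le
  have w0 : w 0 = 1 - w 1 - w 2 := by linarith
  have key : ∀ k : ℤ, lin k (w 0 • cornerPoint s c β ε 0 + w 1 • cornerPoint s c β ε 1 +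
      w 2 • cornerPoint s c β ε 2) =
      c + 1 - 2 * w 1 + (s - k) * (w 2 * ε - w 0 * β) + (s - k) ^ 2 := by
    intro k
    simp only [lin, cornerPoint_apply, corner, PiLp.add_apply, PiLp.smul_apply, smul_eq_mul]
    simp
    linear_combination ((s : ℝ) ^ 2 + c + 1 - 2 * s * k) * hw
  refine ⟨(key s).trans_lt ?_, lt_of_lt_of_eq ?_ (key (s - 1)).symm,
    lt_of_lt_of_eq ?_ (key (s + 1)).symm⟩ <;> push_cast <;> ring_nf <;> linarith

end Bounds

/-- Inequalities satisfied by the points on the sides of a triangle. -/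
def InTri (s c β ε : ℤ) (p : Plane) : Prop :=
  lin s p ≤ c + 1 ∧ c ≤ lin (s - 1) p ∧ c ≤ lin (s + 1) p ∧
    (β = 1 → c + 3 ≤ lin (s - 2) p) ∧ (ε = 1 → c + 3 ≤ lin (s + 2) p)

theorem inTri_of_mem_segment {s c β ε : ℤ} {hβ : 0 < β} {hε : 0 < ε} (hβ2 : β ≤ 2) (hε2 : ε ≤ 2)
    {i j : Fin 3} {p : Plane}
    (hp : p ∈ segment ℝ ((tri s c β ε hβ hε).points i) ((tri s c β ε hβ hε).points j)) :
    InTri s c β ε p :=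
  ⟨lin_le_of_mem_segment hp (lin_corner_le i) (lin_corner_le j),
    le_lin_of_mem_segment hp (le_lin_corner_sub hβ2 hε i) (le_lin_corner_sub hβ2 hε j),
    le_lin_of_mem_segment hp (le_lin_corner_add hβ hε2 i) (le_lin_corner_add hβ hε2 j),
    fun h => le_lin_of_mem_segment hp (le_lin_corner_sub_two h.le hε i)
      (le_lin_corner_sub_two h.le hε j),
    fun h => le_lin_of_mem_segment hp (le_lin_corner_add_two hβ h.le i)
      (le_lin_corner_add_two hβ h.le j)⟩

/-! ### Which triangles can meet in more than a point. -/

theorem plane_ext {p q : Plane} (h0 : p 0 = q 0) (h1 : p 1 = q 1) : p = q := by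
  ext i
  fin_cases i <;> assumption

theorem eq_of_lin_eq {k : ℤ} {p q : Plane} (h1 : p 1 = q 1) (h : lin k p = lin k q) : p = q := by
  refine plane_ext ?_ h1
  simp only [lin, h1] at h
  linarith

/-- At a common point the difference `lin (k + 1) - lin k` grows by 2 with each `k`, is at least
`-1` at `k = s` and at most `1` at `k = s' - 1`; hence `s' ≤ s + 2`. In every excluded case the
inequalities become equalities that fix both a height and a value of `lin`, so `p = q`. -/
theorem contact_cases {s c β ε s' c' β' ε' : ℤ} {p q : Plane} (hpq : p ≠ q)
    (hp : InTri s c β ε p) (hq : InTri s c β ε q) (hp' : InTri s' c' β' ε' p)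
    (hq' : InTri s' c' β' ε' q) (hs : s ≤ s') (hne : s = s' → c ≠ c')
    (h2 : ∃ k, c = s + 2 * k) (h2' : ∃ k, c' = s' + 2 * k) :
    s' = s + 1 ∧ (c' = c + 1 ∧ β' ≠ 1 ∨ c' = c - 1 ∧ ε ≠ 1) := by
  obtain ⟨k, hk⟩ := h2
  obtain ⟨k', hk'⟩ := h2'
  obtain ⟨p1, p2, p3, p4, p5⟩ := hp
  obtain ⟨q1, q2, q3, q4, q5⟩ := hq
  obtain ⟨p1', p2', p3', p4', p5'⟩ := hp'
  obtain ⟨q1', q2', q3', q4', q5'⟩ := hq'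
  simp only [lin] at *
  push_cast at *
  have hlt : s' < s + 3 := by
    have : (s' : ℝ) < s + 3 := by linarith
    exact_mod_cast this
  obtain rfl | rfl | rfl : s' = s ∨ s' = s + 1 ∨ s' = s + 2 := by omega
  -- By parity the values of `c` differ by at least 2, so the slabs `c - 1 ≤ lin s ≤ c + 1` share at
  -- most a line, and on it only the point at height `2s` remains.
  · exfalso
    have hc := hne rfl
    rcases lt_or_gt_of_ne hc with h | h
    · have h3 : c + 2 ≤ c' := by omega
      have h4 : (c + 2 : ℝ) ≤ c' := by exact_mod_cast h3
      refine hpq (eq_of_lin_eq (k := s') ?_ ?_) <;> simp only [lin] <;> linarith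
    · have h3 : c' + 2 ≤ c := by omega
      have h4 : (c' + 2 : ℝ) ≤ c := by exact_mod_cast h3
      refine hpq (eq_of_lin_eq (k := s') ?_ ?_) <;> simp only [lin] <;> linarith
  · refine ⟨rfl, ?_⟩
    push_cast at *
    have h3 : c ≤ c' + 1 := by
      have : (c : ℝ) ≤ c' + 1 := by linarith
      exact_mod_cast this
    have h4 : c' ≤ c + 1 := by
      have : (c' : ℝ) ≤ c + 1 := by linarith
      exact_mod_cast this
    obtain rfl | rfl : c' = c + 1 ∨ c' = c - 1 := by omega
    -- Here `lin s = c + 1`; if `β' = 1`, the extra bound forces height at least `2s + 2`, while `c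
    -- ≤ lin (s + 1)` forces at most `2s + 2`.
    · refine .inl ⟨rfl, fun h => ?_⟩
      have p6 := p4' h
      have q6 := q4' h
      push_cast at *
      refine hpq (eq_of_lin_eq (k := s) ?_ ?_) <;> simp only [lin] <;> linarith
    · refine .inr ⟨rfl, fun h => ?_⟩
      have p6 := p5 h
      have q6 := q5 h
      push_cast at *
      refine hpq (eq_of_lin_eq (k := s) ?_ ?_) <;> simp only [lin] <;> linarith
  · exfalso
    push_cast at *
    refine hpq (eq_of_lin_eq (k := s) ?_ ?_) <;> simp only [lin] <;> linarith

/-- The difference argument with strict bounds gives `s' ≤ s + 1`. For `s' = s` it leaves `|c - c'|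
< 2`, for `s' = s + 1` it leaves `c = c'`; parity excludes both. -/
theorem disjoint_interior_tri_of_le {s c β ε s' c' β' ε' : ℤ} {hβ : 0 < β} {hε : 0 < ε}
    {hβ' : 0 < β'} {hε' : 0 < ε'} (hβ2 : β ≤ 2) (hε2 : ε ≤ 2) (hβ2' : β' ≤ 2) (hε2' : ε' ≤ 2)
    (hs : s ≤ s') (hne : s = s' → c ≠ c') (h2 : ∃ k, c = s + 2 * k) (h2' : ∃ k, c' = s' + 2 * k) :
    Disjoint (tri s c β ε hβ hε).interior (tri s' c' β' ε' hβ' hε').interior := by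
  rw [Set.disjoint_left]
  intro p hp hp'
  obtain ⟨k, hk⟩ := h2
  obtain ⟨k', hk'⟩ := h2'
  obtain ⟨p1, p2, p3⟩ := lin_interior hβ2 hε2 hp
  obtain ⟨p1', p2', p3'⟩ := lin_interior hβ2' hε2' hp'
  simp only [lin] at *
  push_cast at *
  have hlt : s' < s + 2 := by
    have : (s' : ℝ) < s + 2 := by linarith
    exact_mod_cast this
  obtain rfl | rfl : s' = s ∨ s' = s + 1 := by omega
  · have hc := hne rfl
    have h3 : c < c' + 2 := by
      have : (c : ℝ) < c' + 2 := by linarith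
      exact_mod_cast this
    have h4 : c' < c + 2 := by
      have : (c' : ℝ) < c + 2 := by linarith
      exact_mod_cast this
    omega
  · push_cast at *
    have h3 : c < c' + 1 := by
      have : (c : ℝ) < c' + 1 := by linarith
      exact_mod_cast this
    have h4 : c' < c + 1 := by
      have : (c' : ℝ) < c + 1 := by linarith
      exact_mod_cast this
    omega

/-! ### Contacts that do occur. -/

theorem SidesTouch.symm {S T : Affine.Triangle ℝ Plane} (h : SidesTouch S T) : SidesTouch T S := by
  obtain ⟨i, j, k, l, hij, hkl, h⟩ := h
  exact ⟨k, l, i, j, hkl, hij, by rwa [Set.inter_comm]⟩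

theorem mem_segment_of_coord {p q x : Plane} {t : ℝ} (h0 : 0 ≤ t) (h1 : t ≤ 1)
    (hx : ∀ i, x i = (1 - t) * p i + t * q i) : x ∈ segment ℝ p q := by
  refine ⟨1 - t, t, by linarith, h0, by ring, ?_⟩
  ext i
  simp [hx]

/-- The base covers heights `2s - 1` to `2s + 1` at least, and the bottom side of the other triangle
runs from `2s` to `2s + 2` on the same line. The witnesses are its points at heights `2s` and `2s +
1`. -/
theorem sidesTouch_bottom {s c β ε ε' : ℤ} {hβ : 0 < β} {hε : 0 < ε} {hε' : 0 < ε'} :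
    SidesTouch (tri s c β ε hβ hε) (tri (s + 1) (c + 1) 2 ε' two_pos hε') := by
  have hβ1 : (1 : ℝ) ≤ β := by exact_mod_cast hβ
  have hε1 : (1 : ℝ) ≤ ε := by exact_mod_cast hε
  have hpos : (0 : ℝ) < β + ε := by linarith
  refine ⟨0, 2, 0, 1, by decide, by decide, !₂[(s ^ 2 + c + 1 : ℝ), 2 * s], ⟨?_, ?_⟩,
    !₂[(s ^ 2 + s + c + 1 : ℝ), 2 * s + 1], ⟨?_, ?_⟩, fun h => ?_⟩
  · refine mem_segment_of_coord (t := β / (β + ε)) (by positivity)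
      ((div_le_one hpos).2 (by linarith)) fun i => ?_
    fin_cases i <;> simp [tri, cornerPoint_apply, corner] <;> field_simp <;> ring
  · refine mem_segment_of_coord (t := 0) (by norm_num) (by norm_num) fun i => ?_
    fin_cases i <;> simp [tri, cornerPoint_apply, corner] <;> ring
  · refine mem_segment_of_coord (t := (β + 1) / (β + ε)) (by positivity)
      ((div_le_one hpos).2 (by linarith)) fun i => ?_
    fin_cases i <;> simp [tri, cornerPoint_apply, corner] <;> field_simp <;> ring
  · refine mem_segment_of_coord (t := 1 / 2) (by norm_num) (by norm_num) fun i => ?_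
    fin_cases i <;> simp [tri, cornerPoint_apply, corner] <;> ring
  · have := congrArg (fun p : Plane => p 1) h
    simp at this

/-- Mirror image: the witnesses are at heights `2s` and `2s - 1`. -/
theorem sidesTouch_top {s c β ε β' : ℤ} {hβ : 0 < β} {hε : 0 < ε} {hβ' : 0 < β'} :
    SidesTouch (tri s c β ε hβ hε) (tri (s - 1) (c + 1) β' 2 hβ' two_pos) := by
  have hβ1 : (1 : ℝ) ≤ β := by exact_mod_cast hβ
  have hε1 : (1 : ℝ) ≤ ε := by exact_mod_cast hε
  have hpos : (0 : ℝ) < β + ε := by linarith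
  refine ⟨0, 2, 2, 1, by decide, by decide, !₂[(s ^ 2 + c + 1 : ℝ), 2 * s], ⟨?_, ?_⟩,
    !₂[(s ^ 2 - s + c + 1 : ℝ), 2 * s - 1], ⟨?_, ?_⟩, fun h => ?_⟩
  · refine mem_segment_of_coord (t := β / (β + ε)) (by positivity)
      ((div_le_one hpos).2 (by linarith)) fun i => ?_
    fin_cases i <;> simp [tri, cornerPoint_apply, corner] <;> field_simp <;> ring
  · refine mem_segment_of_coord (t := 0) (by norm_num) (by norm_num) fun i => ?_
    fin_cases i <;> simp [tri, cornerPoint_apply, corner] <;> ring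
  · refine mem_segment_of_coord (t := (β - 1) / (β + ε))
      (div_nonneg (by linarith) hpos.le) ((div_le_one hpos).2 (by linarith)) fun i => ?_
    fin_cases i <;> simp [tri, cornerPoint_apply, corner] <;> field_simp <;> ring
  · refine mem_segment_of_coord (t := 1 / 2) (by norm_num) (by norm_num) fun i => ?_
    fin_cases i <;> simp [tri, cornerPoint_apply, corner] <;> ring
  · have := congrArg (fun p : Plane => p 1) h
    simp at this
    linarith

/-! ### Representing subgraphs of both grids. -/

/-- The extent (in half units) of the side of `v` towards the neighbour at offset `-d`. -/
noncomputable def extent {V : Type*} (E : V → V → Prop) (φ : V → ℤ × ℤ) (d : ℤ × ℤ) (v : V) : ℤ :=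
  open Classical in if ∃ u, E v u ∧ φ v = φ u + d then 2 else 1

section Extent

variable {V : Type*} {E : V → V → Prop} {φ : V → ℤ × ℤ} {d : ℤ × ℤ}

theorem extent_pos (v : V) : 0 < extent E φ d v := by
  unfold extent; split_ifs <;> decide

theorem extent_le (v : V) : extent E φ d v ≤ 2 := by
  unfold extent; split_ifs <;> decide

theorem extent_eq_two {u v : V} (h : E v u) (hd : φ v = φ u + d) : extent E φ d v = 2 :=
  if_pos ⟨u, h, hd⟩

theorem exists_of_extent_ne_one {v : V} (h : extent E φ d v ≠ 1) :
    ∃ u, E v u ∧ φ v = φ u + d := by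
  by_contra h'
  exact h (if_neg h')

end Extent

/-- The triangles representing a subgraph `G` of the square grid, placed by `φ`. -/
noncomputable def gridTri {V : Type*} (E : V → V → Prop) (φ : V → ℤ × ℤ) (v : V) :
    Affine.Triangle ℝ Plane :=
  tri ((φ v).1 - (φ v).2) ((φ v).1 + (φ v).2) (extent E φ (1, 0) v) (extent E φ (0, 1) v)
    (extent_pos v) (extent_pos v)

theorem tri_congr {s c β ε s' c' β' ε' : ℤ} {hβ : 0 < β} {hε : 0 < ε} {hβ' : 0 < β'} {hε' : 0 < ε'}
    (h1 : s = s') (h2 : c = c') (h3 : β = β') (h4 : ε = ε') :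
    tri s c β ε hβ hε = tri s' c' β' ε' hβ' hε' := by
  subst h1 h2 h3 h4; rfl

section Rep

variable {V : Type*} {G : SimpleGraph V} (φ : SimpleGraph.Copy G squareGrid)

theorem sidesTouch_of_eq_add_left {u v : V} (h : G.Adj v u) (huv : φ v = φ u + (1, 0)) :
    SidesTouch (gridTri G.Adj φ u) (gridTri G.Adj φ v) := by
  have h2 : extent G.Adj φ (1, 0) v = 2 := extent_eq_two h huv
  have := @sidesTouch_bottom ((φ u).1 - (φ u).2) ((φ u).1 + (φ u).2) _ _ _
    (extent_pos (E := G.Adj) (φ := φ) (d := (1, 0)) u)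
    (extent_pos (E := G.Adj) (φ := φ) (d := (0, 1)) u)
    (extent_pos (E := G.Adj) (φ := φ) (d := (0, 1)) v)
  convert this using 1
  · rfl
  · refine tri_congr ?_ ?_ h2 rfl <;> simp [huv] <;> ring

theorem sidesTouch_of_eq_add_right {u v : V} (h : G.Adj v u) (huv : φ v = φ u + (0, 1)) :
    SidesTouch (gridTri G.Adj φ u) (gridTri G.Adj φ v) := by
  have h2 : extent G.Adj φ (0, 1) v = 2 := extent_eq_two h huv
  have := @sidesTouch_top ((φ u).1 - (φ u).2) ((φ u).1 + (φ u).2) _ _ _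
    (extent_pos (E := G.Adj) (φ := φ) (d := (1, 0)) u)
    (extent_pos (E := G.Adj) (φ := φ) (d := (0, 1)) u)
    (extent_pos (E := G.Adj) (φ := φ) (d := (1, 0)) v)
  convert this using 1
  · rfl
  · refine tri_congr ?_ ?_ rfl h2 <;> simp [huv] <;> ring

theorem squareGrid_adj_cases {p q : ℤ × ℤ} (h : squareGrid.Adj p q) :
    p = q + (1, 0) ∨ q = p + (1, 0) ∨ p = q + (0, 1) ∨ q = p + (0, 1) := by
  obtain ⟨a, b⟩ := p
  obtain ⟨a', b'⟩ := q
  change |a - a'| + |b - b'| = 1 at h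
  simp only [Prod.mk_add_mk, Prod.mk.injEq]
  rcases abs_cases (a - a') with h1 | h1 <;> rcases abs_cases (b - b') with h2 | h2 <;> omega

theorem gridTri_disjoint_and_adj {u v : V} (huv : u ≠ v)
    (hle : (φ u).1 - (φ u).2 ≤ (φ v).1 - (φ v).2) :
    Disjoint (gridTri G.Adj φ u).interior (gridTri G.Adj φ v).interior ∧
      (G.Adj u v ↔ SidesTouch (gridTri G.Adj φ u) (gridTri G.Adj φ v)) := by
  have hinj : Function.Injective φ := φ.injective
  have hne : (φ u).1 - (φ u).2 = (φ v).1 - (φ v).2 → (φ u).1 + (φ u).2 ≠ (φ v).1 + (φ v).2 :=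
    fun h1 h2 => huv (hinj (Prod.ext (by omega) (by omega)))
  have h2 : ∀ w, ∃ k, (φ w).1 + (φ w).2 = (φ w).1 - (φ w).2 + 2 * k :=
    fun w => ⟨(φ w).2, by ring⟩
  refine ⟨disjoint_interior_tri_of_le (extent_le u) (extent_le u) (extent_le v) (extent_le v) hle
    hne (h2 u) (h2 v), fun h => ?_, fun h => ?_⟩
  · rcases squareGrid_adj_cases (φ.toHom.map_adj h) with h' | h' | h' | h'
    · exact (sidesTouch_of_eq_add_left φ h h').symm
    · exact sidesTouch_of_eq_add_left φ h.symm h'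
    · exact (sidesTouch_of_eq_add_right φ h h').symm
    · exact sidesTouch_of_eq_add_right φ h.symm h'
  · obtain ⟨i, j, k, l, -, -, p, ⟨hp, hp'⟩, q, ⟨hq, hq'⟩, hpq⟩ := h
    have hu : ∀ w, extent G.Adj φ (1, 0) w ≤ 2 ∧ extent G.Adj φ (0, 1) w ≤ 2 :=
      fun w => ⟨extent_le w, extent_le w⟩
    obtain ⟨h1, ⟨h3, h4⟩ | ⟨h3, h4⟩⟩ := contact_cases hpq
      (inTri_of_mem_segment (hu u).1 (hu u).2 hp) (inTri_of_mem_segment (hu u).1 (hu u).2 hq)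
      (inTri_of_mem_segment (hu v).1 (hu v).2 hp') (inTri_of_mem_segment (hu v).1 (hu v).2 hq')
      hle hne (h2 u) (h2 v)
    · obtain ⟨w, hw, hw'⟩ := exists_of_extent_ne_one h4
      -- An enlarged side only reveals some edge in this direction; injectivity of the placement
      -- identifies its other end.
      have : w = u := hinj (Prod.ext (by simp [Prod.ext_iff] at hw'; omega)
        (by simp [Prod.ext_iff] at hw'; omega))
      exact this ▸ hw.symm
    · obtain ⟨w, hw, hw'⟩ := exists_of_extent_ne_one h4
      have : w = v := hinj (Prod.ext (by simp [Prod.ext_iff] at hw'; omega)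
        (by simp [Prod.ext_iff] at hw'; omega))
      exact this ▸ hw

theorem isTTRep_gridTri : IsTTRep G (gridTri G.Adj φ) := by
  intro u v huv
  rcases le_total ((φ u).1 - (φ u).2) ((φ v).1 - (φ v).2) with h | h
  · exact gridTri_disjoint_and_adj φ huv h
  · obtain ⟨h1, h2⟩ := gridTri_disjoint_and_adj φ huv.symm h
    exact ⟨h1.symm, by rw [G.adj_comm, h2]; exact ⟨.symm, .symm⟩⟩

end Rep

/-- The hexagonal grid as a subgraph of the square grid (a brick wall). -/
def hexToSquare : SimpleGraph.Copy hexGrid squareGrid where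
  toHom :=
    { toFun := fun p => (2 * p.1 + p.2.1 + if p.2.2 then 1 else 0, p.2.1)
      map_rel' := by
        have key : ∀ p q, HexStep p q → squareGrid.Adj
            ((2 * p.1 + p.2.1 + if p.2.2 then 1 else 0, p.2.1) : ℤ × ℤ)
            (2 * q.1 + q.2.1 + if q.2.2 then 1 else 0, q.2.1) := by
          rintro ⟨a, b, t⟩ ⟨a', b', t'⟩ ⟨h1, h2, h⟩
          simp only at h1 h2 h
          subst h1 h2
          simp only [squareGrid]
          rcases h with ⟨rfl, rfl⟩ | ⟨rfl, rfl⟩ | ⟨rfl, rfl⟩ <;> simp <;> ring_nf <;> simp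
        rintro p q (h | h)
        · exact key _ _ h
        · exact (key _ _ h).symm }
  injective' := by
    rintro ⟨a, b, t⟩ ⟨a', b', t'⟩ h
    simp at h
    obtain ⟨h, rfl⟩ := h
    -- Equal second coordinates leave `2a + t`, whose parity determines `t`.
    cases t <;> cases t' <;> simp at h ⊢ <;> omega

theorem exists_isTTRep {V : Type*} (G : SimpleGraph V)
    (h : G.IsContained squareGrid ∨ G.IsContained hexGrid) :
    ∃ T : V → Affine.Triangle ℝ Plane, IsTTRep G T := by
  rcases h with ⟨⟨φ⟩⟩ | ⟨⟨φ⟩⟩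
  · exact ⟨_, isTTRep_gridTri φ⟩
  · exact ⟨_, isTTRep_gridTri (hexToSquare.comp φ)⟩

/-! ### Reasoning about programs -/

@[simp] theorem Config.reg_setReg (s : Config) (r r' : ℕ) (x : ℤ) :
    (s.setReg r x).reg r' = if r' = r then x else s.reg r' := by
  simp [Config.setReg, Function.update_apply]

@[simp] theorem Config.mem_setReg (s : Config) (r : ℕ) (x : ℤ) : (s.setReg r x).mem = s.mem := rfl

@[simp] theorem Config.reg_setMem (s : Config) (a x : ℤ) : (s.setMem a x).reg = s.reg := rfl

@[simp] theorem Config.mem_setMem (s : Config) (a x a' : ℤ) :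
    (s.setMem a x).mem a' = if a' = a then x else s.mem a' := by
  simp [Config.setMem, Function.update_apply]

/-- Started in `s`, the program halts after at most `T` steps in a configuration satisfying `Q`. -/
def Runs (W : ℤ) (p : Program) (T : ℕ) (s : Config) (Q : Config → Prop) : Prop :=
  ∃ t s', Exec W p s t s' ∧ t ≤ T ∧ Q s'

section Runs

variable {W : ℤ} {p q : Program} {T T' : ℕ} {s s' : Config} {P Q : Config → Prop}

theorem Runs.last (h : Exec W p s 1 s') (hQ : Q s') : Runs W p 1 s Q :=
  ⟨1, s', h, le_rfl, hQ⟩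

theorem Runs.step (h : Exec W p s 1 s') (hq : Runs W q T s' Q) : Runs W (.seq p q) (T + 1) s Q := by
  obtain ⟨t, s₂, h₂, ht, hQ⟩ := hq
  exact ⟨1 + t, s₂, .seq h h₂, by omega, hQ⟩

theorem Runs.seq (h : Runs W p T s P) (hq : ∀ s', P s' → Runs W q T' s' Q) :
    Runs W (.seq p q) (T + T') s Q := by
  obtain ⟨t, s₁, h₁, ht, hP⟩ := h
  obtain ⟨t', s₂, h₂, ht', hQ⟩ := hq s₁ hP
  exact ⟨t + t', s₂, .seq h₁ h₂, by omega, hQ⟩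

theorem Runs.mono (h : Runs W p T s P) (hT : T ≤ T') (hPQ : ∀ s', P s' → Q s') :
    Runs W p T' s Q := by
  obtain ⟨t, s₁, h₁, ht, hP⟩ := h
  exact ⟨t, s₁, h₁, ht.trans hT, hPQ _ hP⟩

theorem Runs.ite {r : ℕ} (hp : 0 < s.reg r → Runs W p T s Q) (hq : s.reg r ≤ 0 → Runs W q T s Q) :
    Runs W (.ite r p q) (T + 1) s Q := by
  rcases lt_or_ge 0 (s.reg r) with h | h
  · obtain ⟨t, s₁, h₁, ht, hQ⟩ := hp h
    exact ⟨t + 1, s₁, .ite_pos h h₁, by omega, hQ⟩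
  · obtain ⟨t, s₁, h₁, ht, hQ⟩ := hq h
    exact ⟨t + 1, s₁, .ite_neg h h₁, by omega, hQ⟩

/-- `I i` is the state after `i` rounds. Each round pays one step for its test, and the final
failing test gives the extra `1`. -/
theorem Runs.loop {r : ℕ} (I : ℕ → Config → Prop) (N : ℕ)
    (hstep : ∀ i s, i < N → I i s → 0 < s.reg r ∧ Runs W p T s (I (i + 1)))
    (hend : ∀ s, I N s → s.reg r ≤ 0) (h0 : I 0 s) :
    Runs W (.loop r p) (N * (T + 1) + 1) s (I N) := by
  suffices h : ∀ k i s, i + k = N → I i s → Runs W (.loop r p) (k * (T + 1) + 1) s (I N) from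
    h N 0 s (by omega) h0
  intro k
  induction k with
  | zero =>
    rintro i s rfl hi
    exact ⟨1, s, .loop_neg (hend s hi), by omega, hi⟩
  | succ k ih =>
    intro i s hik hi
    obtain ⟨hr, t, s₁, h₁, ht, hs₁⟩ := hstep i s (by omega) hi
    obtain ⟨t', s₂, h₂, ht', hs₂⟩ := ih (i + 1) s₁ (by omega) hs₁
    exact ⟨t + t' + 1, s₂, .loop_pos hr h₁ h₂, by rw [add_mul]; omega, hs₂⟩

end Runs

/-! ### The program -/

/-- Write the six words of the triangle with `β = ε = 1`, advance the pointers. -/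
def writeTriangle : Program :=
  .seq (.sub 16 11 12) <| .seq (.add 17 11 12) <| .seq (.mul 18 16 16) <| .seq (.add 18 18 17) <|
  .seq (.sub 19 18 16) <| .seq (.add 19 19 1) <| .seq (.store 7 19) <| .seq (.add 7 7 1) <|
  .seq (.add 20 16 16) <| .seq (.sub 19 20 1) <| .seq (.store 7 19) <| .seq (.add 7 7 1) <|
  .seq (.sub 19 18 1) <| .seq (.store 7 19) <| .seq (.add 7 7 1) <|
  .seq (.store 7 20) <| .seq (.add 7 7 1) <|
  .seq (.add 19 18 16) <| .seq (.add 19 19 1) <| .seq (.store 7 19) <| .seq (.add 7 7 1) <|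
  .seq (.add 19 20 1) <| .seq (.store 7 19) <| .seq (.add 7 7 1) <|
  .seq (.add 10 10 5) <| .sub 6 6 1

/-- Replace a corner of the triangle of the vertex in register `w`. -/
def writeCorner (w sw cw so : ℕ) : Program :=
  .seq (.sub 23 sw so) <| .seq (.add 23 23 23) <| .seq (.sub 23 2 23) <| .seq (.add 23 23 0) <|
  .seq (.const 24 6) <| .seq (.mul 24 w 24) <| .seq (.add 23 23 24) <| .seq (.mul 24 so so) <|
  .seq (.add 24 24 cw) <| .seq (.store 23 24) <| .seq (.add 23 23 1) <| .seq (.add 24 so so) <|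
  .store 23 24

/-- Read a vertex number of the list of edges. -/
def readVertex (r : ℕ) : Program :=
  .seq (.load 10 8) <| .seq (.add 8 8 1) <| .seq (.add r 10 9) <| .seq (.mul 10 10 5) <|
  .add 10 10 2

/-- The coordinates of the triangle at a vertex. -/
def readSlope (rs rc : ℕ) : Program := .seq (.sub rs 11 12) (.add rc 11 12)

/-- Process an edge. -/
def processEdge (ld : Program) : Program :=
  .seq (readVertex 21) <| .seq ld <| .seq (readSlope 16 17) <|
  .seq (readVertex 22) <| .seq ld <| .seq (readSlope 18 19) <|
  .seq (.sub 20 17 19) <|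
  .seq (.ite 20 (writeCorner 21 16 17 18) (writeCorner 22 18 19 16)) <| .sub 6 6 1

def initRegisters (d : ℕ) : Program :=
  -- Register 0 is still 0 and register 1 is 1, so the two loads fetch the header. Register 5 holds
  -- `-6` only to set register 0 to `-6n`: the output fills the cells just below 0 and spares the
  -- input. Register 9 is never written and serves as zero for copying.
  .seq (.const 1 1) <| .seq (.load 3 0) <| .seq (.load 4 1) <| .seq (.const 5 (-6)) <|
  .seq (.mul 0 5 3) <| .seq (.const 10 2) <| .seq (.const 5 d) <| .seq (.const 2 2) <|
  .seq (.add 7 0 9) <| .add 6 3 9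

/-- The whole program; `ld` loads the coordinates of a vertex whose record begins at the address in
register `10`, and `d` is the length of the records. -/
def gridProgram (ld : Program) (d : ℕ) : Program :=
  .seq (initRegisters d) <| .seq (.loop 6 (.seq ld writeTriangle)) <|
  .seq (.add 8 10 9) <| .seq (.add 6 4 9) <| .loop 6 (processEdge ld)

/-! ### Correctness and cost of the straight-line blocks. -/

section Blocks

variable {W : ℤ} {s : Config}

theorem runs_writeTriangle {x y a r10 r6 N: ℤ} {d : ℕ} (hx : s.reg 11 = x) (hy : s.reg 12 = y)
    (ha : s.reg 7 = a) (h10 : s.reg 10 = r10) (h6 : s.reg 6 = r6) (h1 : s.reg 1 = 1)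
    (h5 : s.reg 5 = d) (hN : 1 ≤ N) (hW : 1000 * (N * N) ≤ W) (bx : |x| ≤ 4 * N) (by' : |y| ≤ 4 * N)
    (ba : |a| ≤ 6 * N) (b10 : |r10| ≤ 10 * N) (bd : d ≤ 10) (b6 : |r6| ≤ N) :
    Runs W writeTriangle 26 s fun s' =>
      (∀ r, r = 0 ∨ r = 1 ∨ r = 2 ∨ r = 4 ∨ r = 5 ∨ r = 9 → s'.reg r = s.reg r) ∧
      s'.reg 7 = a + 6 ∧ s'.reg 10 = r10 + d ∧ s'.reg 6 = r6 - 1 ∧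
      (∀ (i : Fin 3) (j : Fin 2), s'.mem (a + 2 * (i : ℕ) + (j : ℕ)) = corner (x - y) (x + y) 1 1 i j) ∧
      (∀ b, b < a ∨ a + 6 ≤ b → s'.mem b = s.mem b) := by
  obtain ⟨bx1, bx2⟩ := abs_le.1 bx
  obtain ⟨by1, by2⟩ := abs_le.1 by'
  obtain ⟨ba1, ba2⟩ := abs_le.1 ba
  obtain ⟨b101, b102⟩ := abs_le.1 b10
  obtain ⟨b61, b62⟩ := abs_le.1 b6
  have bd' : (d : ℤ) ≤ 10 := by exact_mod_cast bd
  have hd0 : (0 : ℤ) ≤ d := by positivity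
  have q0 : 0 ≤ (x - y) * (x - y) := mul_self_nonneg _
  -- The square is the only quantity not linear in `N`; the factor 1000 absorbs everything else.
  have q1 : (x - y) * (x - y) ≤ 64 * (N * N) := by nlinarith
  have q2 : N ≤ N * N := by nlinarith
  unfold writeTriangle
  refine .step (.sub _ _ _ _ ?_) <| .step (.add _ _ _ _ ?_) <| .step (.mul _ _ _ _ ?_) <|
    .step (.add _ _ _ _ ?_) <| .step (.sub _ _ _ _ ?_) <| .step (.add _ _ _ _ ?_) <|
    .step (.store _ _ _) <| .step (.add _ _ _ _ ?_) <|
    .step (.add _ _ _ _ ?_) <| .step (.sub _ _ _ _ ?_) <|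
    .step (.store _ _ _) <| .step (.add _ _ _ _ ?_) <|
    .step (.sub _ _ _ _ ?_) <|
    .step (.store _ _ _) <| .step (.add _ _ _ _ ?_) <|
    .step (.store _ _ _) <| .step (.add _ _ _ _ ?_) <|
    .step (.add _ _ _ _ ?_) <| .step (.add _ _ _ _ ?_) <|
    .step (.store _ _ _) <| .step (.add _ _ _ _ ?_) <|
    .step (.add _ _ _ _ ?_) <|
    .step (.store _ _ _) <| .step (.add _ _ _ _ ?_) <|
    .step (.add _ _ _ _ ?_) <| .last (.sub _ _ _ _ ?_) ?_
  case refine_21 =>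
    refine ⟨?_, ?_, ?_, ?_, ?_, ?_⟩
    · rintro r (rfl | rfl | rfl | rfl | rfl | rfl) <;> simp
    · simp [ha, h1]
      ring
    · simp [h10, h5]
    · simp [h6, h1]
    · intro i j
      simp [hx, hy, ha, h1]
      fin_cases i <;> fin_cases j <;> simp [corner, add_assoc] <;> ring
    · intro b hb
      simp [ha, h1]
      repeat rw [if_neg (by omega)]
  all_goals
    simp [hx, hy, ha, h10, h6, h1, h5]
    first
      | exact abs_le.2 ⟨by linarith, by linarith⟩
      | linarith

/-- Along an edge `xs - xo = ±1`, so the offset `2 - 2 (xs - xo)` is 0 or 4, selecting the bottom or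
the top corner. Enlarged, either corner is `(xo² + xc, 2 xo)`, so no case distinction is needed. -/
theorem runs_writeCorner {w sw cw so : ℕ} {base i xs xc xo N : ℤ} (hw : w < 23)
    (hcw : cw < 23) (hso : so < 23) (h0 : s.reg 0 = base) (h1 : s.reg 1 = 1) (h2 : s.reg 2 = 2)
    (hi : s.reg w = i) (hxs : s.reg sw = xs) (hxc : s.reg cw = xc) (hxo : s.reg so = xo)
    (hN : 1 ≤ N) (hW : 1000 * (N * N) ≤ W) (bb : |base| ≤ 6 * N) (bi : |i| ≤ N)
    (bs : |xs| ≤ 8 * N) (bc : |xc| ≤ 8 * N) (bo : |xo| ≤ 8 * N) :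
    Runs W (writeCorner w sw cw so) 13 s fun s' =>
      (∀ r < 23, s'.reg r = s.reg r) ∧
      s'.mem (base + 6 * i + 2 - 2 * (xs - xo)) = xo * xo + xc ∧
      s'.mem (base + 6 * i + 2 - 2 * (xs - xo) + 1) = 2 * xo ∧
      ∀ b, b ≠ base + 6 * i + 2 - 2 * (xs - xo) → b ≠ base + 6 * i + 2 - 2 * (xs - xo) + 1 →
        s'.mem b = s.mem b := by
  obtain ⟨bb1, bb2⟩ := abs_le.1 bb
  obtain ⟨bi1, bi2⟩ := abs_le.1 bi
  obtain ⟨bs1, bs2⟩ := abs_le.1 bs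
  obtain ⟨bc1, bc2⟩ := abs_le.1 bc
  obtain ⟨bo1, bo2⟩ := abs_le.1 bo
  have q0 : 0 ≤ xo * xo := mul_self_nonneg _
  have q1 : xo * xo ≤ 64 * (N * N) := by nlinarith
  have q2 : N ≤ N * N := by nlinarith
  have hw4 : w ≠ 24 := by omega
  have hcw4 : cw ≠ 24 := by omega
  have hso4 : so ≠ 24 := by omega
  unfold writeCorner
  refine .step (.sub _ _ _ _ ?_) <| .step (.add _ _ _ _ ?_) <| .step (.sub _ _ _ _ ?_) <|
    .step (.add _ _ _ _ ?_) <| .step (.const _ _ _ ?_) <| .step (.mul _ _ _ _ ?_) <|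
    .step (.add _ _ _ _ ?_) <| .step (.mul _ _ _ _ ?_) <| .step (.add _ _ _ _ ?_) <|
    .step (.store _ _ _) <| .step (.add _ _ _ _ ?_) <| .step (.add _ _ _ _ ?_) <|
    .last (.store _ _ _) ?_
  case refine_12 =>
    have hA : 2 - (xs - xo + (xs - xo)) + base + i * 6 = base + 6 * i + 2 - 2 * (xs - xo) := by
      ring
    refine ⟨?_, ?_, ?_, ?_⟩
    · intro r hr
      simp [hr.ne, show r ≠ 24 by omega]
    · simp [h0, h1, h2, hi, hxs, hxc, hxo, hw.ne, hcw.ne, hso.ne, hw4, hcw4, hso4, hA]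
    · simp [h0, h1, h2, hi, hxs, hxc, hxo, hw.ne, hcw.ne, hso.ne, hw4, hcw4, hso4, hA]
      ring
    · intro b hb hb'
      simp [h0, h1, h2, hi, hxs, hxo, hw.ne, hso.ne, hw4, hso4, hA, hb, hb']
  all_goals
    simp [h0, h1, h2, hi, hxs, hxc, hxo, hw.ne, hcw.ne, hso.ne, hw4, hcw4, hso4]
    first
      | exact abs_le.2 ⟨by linarith, by linarith⟩
      | linarith

theorem runs_readVertex {r d : ℕ} {a i N : ℤ} (hr : 16 ≤ r) (h8 : s.reg 8 = a)
    (hi : s.mem a = i) (h1 : s.reg 1 = 1) (h2 : s.reg 2 = 2) (h5 : s.reg 5 = d) (h9 : s.reg 9 = 0)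
    (hN : 1 ≤ N) (hW : 1000 * (N * N) ≤ W) (bd : d ≤ 10) (bi : |i| ≤ N) (ba : |a| ≤ 20 * N) :
    Runs W (readVertex r) 5 s fun s' =>
      (∀ r', r' ≠ 8 → r' ≠ 10 → r' ≠ r → s'.reg r' = s.reg r') ∧
      s'.reg 8 = a + 1 ∧ s'.reg 10 = 2 + d * i ∧ s'.reg r = i ∧ s'.mem = s.mem := by
  obtain ⟨bi1, bi2⟩ := abs_le.1 bi
  obtain ⟨ba1, ba2⟩ := abs_le.1 ba
  have bd' : (d : ℤ) ≤ 10 := by exact_mod_cast bd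
  have hd0 : (0 : ℤ) ≤ d := by positivity
  have q1 : i * d ≤ 10 * N := by nlinarith
  have q1' : -(10 * N) ≤ i * d := by nlinarith
  have q3 : |i| * d ≤ 10 * N := by nlinarith [abs_nonneg i]
  have q2 : N ≤ N * N := by nlinarith
  have r1 : ¬ 1 = r := by omega
  have r2 : ¬ 2 = r := by omega
  have r5 : ¬ 5 = r := by omega
  have r8 : ¬ 8 = r := by omega
  have r9 : ¬ 9 = r := by omega
  have r10 : ¬ 10 = r := by omega
  have r10' : ¬ r = 10 := by omega
  unfold readVertex
  refine .step (.load _ _ _) <| .step (.add _ _ _ _ ?_) <| .step (.add _ _ _ _ ?_) <|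
    .step (.mul _ _ _ _ ?_) <| .last (.add _ _ _ _ ?_) ?_
  case refine_5 =>
    refine ⟨fun r' hr8 hr10 hrr => ?_, ?_, ?_, ?_, rfl⟩
    · simp [hr8, hr10, hrr]
    · simp [h8, h1, r8]
    · simp [h8, hi, h5, h2, r2, r5, r10]
      ring
    · simp [h8, hi, h9, r10']
  all_goals
    simp [h8, hi, h1, h2, h5, h9, r2, r5, r10]
    first
      | exact abs_le.2 ⟨by linarith, by linarith⟩
      | linarith

theorem runs_readSlope {rs rc : ℕ} {x y N : ℤ} (hs : 16 ≤ rs) (hsc : rs ≠ rc)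
    (hx : s.reg 11 = x) (hy : s.reg 12 = y) (hN : 1 ≤ N) (hW : 1000 * (N * N) ≤ W)
    (bx : |x| ≤ 4 * N) (by' : |y| ≤ 4 * N) :
    Runs W (readSlope rs rc) 2 s fun s' =>
      (∀ r', r' ≠ rs → r' ≠ rc → s'.reg r' = s.reg r') ∧
      s'.reg rs = x - y ∧ s'.reg rc = x + y ∧ s'.mem = s.mem := by
  obtain ⟨bx1, bx2⟩ := abs_le.1 bx
  obtain ⟨by1, by2⟩ := abs_le.1 by'
  have q2 : N ≤ N * N := by nlinarith
  have h11 : ¬ 11 = rs := by omega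
  have h12 : ¬ 12 = rs := by omega
  unfold readSlope
  refine .step (.sub _ _ _ _ ?_) <| .last (.add _ _ _ _ ?_) ?_
  case refine_3 =>
    refine ⟨fun r' h1 h2 => ?_, ?_, ?_, rfl⟩
    · simp [h1, h2]
    · simp [hsc, hx, hy]
    · simp [h11, h12, hx, hy]
  all_goals
    simp [hx, hy, h11, h12]
    exact abs_le.2 ⟨by linarith, by linarith⟩

end Blocks

/-- The program `ld` loads the coordinates of the vertex whose record begins at the address in
register `10`. -/
def Loads (W : ℤ) (ld : Program) (T d : ℕ) (m₀ : ℤ → ℤ) {n : ℕ} (pos : Fin n → ℤ × ℤ) : Prop :=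
  ∀ (s : Config) (v : Fin n), s.reg 1 = 1 → s.reg 10 = 2 + d * (v : ℕ) →
    (∀ a, 0 ≤ a → s.mem a = m₀ a) → Runs W ld T s fun s' =>
      s'.mem = s.mem ∧ s'.reg 11 = (pos v).1 ∧ s'.reg 12 = (pos v).2 ∧
        ∀ r, r ≤ 10 ∨ 16 ≤ r → s'.reg r = s.reg r

/-- The cells of the vertex `v` hold the corners of its triangle. -/
def Holds {n : ℕ} (s : Config) (v : Fin n) (p : ℤ × ℤ) (β ε : ℤ) : Prop :=
  ∀ (i : Fin 3) (j : Fin 2),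
    s.mem (-(6 * n) + 6 * (v : ℕ) + 2 * (i : ℕ) + (j : ℕ)) = corner (p.1 - p.2) (p.1 + p.2) β ε i j

theorem runs_processEdge {W N : ℤ} {ld : Program} {T d : ℕ} {m₀ : ℤ → ℤ} {n : ℕ}
    {pos : Fin n → ℤ × ℤ} {s : Config} {a : ℤ} {p q : Fin n} {r6 : ℤ}
    (hld : Loads W ld T d m₀ pos) (hN : 1 ≤ N) (hW : 1000 * (N * N) ≤ W)
    (bpos : ∀ v, |(pos v).1| ≤ 4 * N ∧ |(pos v).2| ≤ 4 * N) (bn : n ≤ N) (bd : d ≤ 10)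
    (ba : |a| ≤ 19 * N) (ha0 : 0 ≤ a) (b6 : |r6| ≤ N)
    (hadj : squareGrid.Adj (pos p) (pos q)) (h0 : s.reg 0 = -(6 * n)) (h1 : s.reg 1 = 1)
    (h2 : s.reg 2 = 2) (h5 : s.reg 5 = d) (h8 : s.reg 8 = a) (h9 : s.reg 9 = 0)
    (h6 : s.reg 6 = r6) (hm : ∀ b, 0 ≤ b → s.mem b = m₀ b) (hp : m₀ a = (p : ℕ))
    (hq : m₀ (a + 1) = (q : ℕ)) :
    Runs W (processEdge ld) (2 * T + 30) s fun s' =>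
      (∀ r, r = 0 ∨ r = 1 ∨ r = 2 ∨ r = 5 ∨ r = 9 → s'.reg r = s.reg r) ∧
      s'.reg 8 = a + 2 ∧ s'.reg 6 = r6 - 1 ∧
      ∃ w o : Fin n, (w = p ∧ o = q ∨ w = q ∧ o = p) ∧
        (pos o).1 + (pos o).2 < (pos w).1 + (pos w).2 ∧
        let A := -(6 * n) + 6 * (w : ℕ) + 2 -
          2 * (((pos w).1 - (pos w).2) - ((pos o).1 - (pos o).2))
        s'.mem A = ((pos o).1 - (pos o).2) * ((pos o).1 - (pos o).2) + ((pos w).1 + (pos w).2) ∧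
        s'.mem (A + 1) = 2 * ((pos o).1 - (pos o).2) ∧
        ∀ b, b ≠ A → b ≠ A + 1 → s'.mem b = s.mem b := by
  have bv : ∀ v : Fin n, |((v : ℕ) : ℤ)| ≤ N := fun v => by
    have := v.2
    rw [Nat.abs_cast]
    omega
  have q2 : N ≤ N * N := by nlinarith
  have bs : ∀ v, |(pos v).1 - (pos v).2| ≤ 8 * N := fun v => by
    have := abs_le.1 (bpos v).1
    have := abs_le.1 (bpos v).2
    exact abs_le.2 ⟨by linarith, by linarith⟩
  have bc : ∀ v, |(pos v).1 + (pos v).2| ≤ 8 * N := fun v => by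
    have := abs_le.1 (bpos v).1
    have := abs_le.1 (bpos v).2
    exact abs_le.2 ⟨by linarith, by linarith⟩
  have hb : |(-(6 * n) : ℤ)| ≤ 6 * N := abs_le.2 ⟨by linarith, by linarith⟩
  have ba' := abs_le.1 ba
  unfold processEdge
  refine Runs.mono (Runs.seq (runs_readVertex (by norm_num) h8 (by rw [hm a ha0]; exact hp) h1 h2
    h5 h9 hN hW bd (bv p) (ba.trans (by linarith))) ?_ (T' := 2 * T + 25)) (by omega) fun _ h => h
  rintro s1 ⟨f1, f18, f110, f121, f1m⟩
  refine Runs.mono (Runs.seq (hld s1 p (by rw [f1] <;> simp [h1]) f110 (by rwa [f1m])) ?_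
    (T' := T + 25)) (by omega) fun _ h => h
  rintro s2 ⟨f2m, f211, f212, f2⟩
  refine Runs.mono (Runs.seq (runs_readSlope (by norm_num) (by norm_num) f211 f212
    hN hW (bpos p).1 (bpos p).2) ?_ (T' := T + 23)) (by omega) fun _ h => h
  rintro s3 ⟨f3, f316, f317, f3m⟩
  have g3 : ∀ r, r < 8 ∨ r = 9 → s3.reg r = s.reg r := fun r hr => by
    rw [f3 r (by omega) (by omega), f2 r (by omega), f1 r (by omega) (by omega) (by omega)]
  have e3 : s3.mem = s.mem := by rw [f3m, f2m, f1m]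
  have g38 : s3.reg 8 = a + 1 := by rw [f3 _ (by norm_num) (by norm_num), f2 _ (by norm_num), f18]
  have g321 : s3.reg 21 = (p : ℕ) := by
    rw [f3 _ (by norm_num) (by norm_num), f2 _ (by norm_num), f121]
  refine Runs.mono (Runs.seq (runs_readVertex (by norm_num) g38
    (by rw [e3, hm (a + 1) (by omega)]; exact hq) (by rw [g3 _ (by norm_num), h1])
    (by rw [g3 _ (by norm_num), h2]) (by rw [g3 _ (by norm_num), h5])
    (by rw [g3 _ (by norm_num), h9]) hN hW bd (bv q) (abs_le.2 ⟨by linarith, by linarith⟩)) ?_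
    (T' := T + 18)) (by omega) fun _ h => h
  rintro s4 ⟨f4, f48, f410, f422, f4m⟩
  refine Runs.mono (Runs.seq (hld s4 q (by rw [f4, g3] <;> simp [h1]) f410
    (by rwa [f4m, e3])) ?_ (T' := 18)) (by omega) fun _ h => h
  rintro s5 ⟨f5m, f511, f512, f5⟩
  refine Runs.mono (Runs.seq (runs_readSlope (by norm_num) (by norm_num) f511 f512
    hN hW (bpos q).1 (bpos q).2) ?_ (T' := 16)) (by omega) fun _ h => h
  rintro s6 ⟨f6, f618, f619, f6m⟩
  have g6 : ∀ r, r < 8 ∨ r = 9 ∨ r = 16 ∨ r = 17 ∨ r = 21 → s6.reg r = s3.reg r := fun r hr => by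
    rw [f6 r (by omega) (by omega), f5 r (by omega), f4 r (by omega) (by omega) (by omega)]
  have k6 : ∀ r, r < 8 ∨ r = 9 → s6.reg r = s.reg r := fun r hr => by
    rw [g6 r (by omega), g3 r hr]
  have e6 : s6.mem = s.mem := by rw [f6m, f5m, f4m, e3]
  have g68 : s6.reg 8 = a + 2 := by
    rw [f6 _ (by norm_num) (by norm_num), f5 _ (by norm_num), f48]; ring
  have g622 : s6.reg 22 = (q : ℕ) := by
    rw [f6 _ (by norm_num) (by norm_num), f5 _ (by norm_num), f422]
  have g616 := (g6 16 (by norm_num)).trans f316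
  have g617 := (g6 17 (by norm_num)).trans f317
  have g621 := (g6 21 (by norm_num)).trans g321
  -- Adjacent grid points never have equal coordinate sums, so the sign test singles out the
  -- endpoint with the larger sum.
  have hcne : (pos p).1 + (pos p).2 ≠ (pos q).1 + (pos q).2 := by
    rcases squareGrid_adj_cases hadj with h | h | h | h <;> simp [Prod.ext_iff] at h <;> omega
  have bcp := abs_le.1 (bc p)
  have bcq := abs_le.1 (bc q)
  refine .step (.sub _ _ _ _ ?_) (Runs.seq (Runs.ite (T := 13) (Q := fun s' =>
      (∀ r < 23, r ≠ 20 → s'.reg r = s6.reg r) ∧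
      ∃ w o : Fin n, (w = p ∧ o = q ∨ w = q ∧ o = p) ∧
        (pos o).1 + (pos o).2 < (pos w).1 + (pos w).2 ∧
        let A := -(6 * n) + 6 * (w : ℕ) + 2 -
          2 * (((pos w).1 - (pos w).2) - ((pos o).1 - (pos o).2))
        s'.mem A = ((pos o).1 - (pos o).2) * ((pos o).1 - (pos o).2) + ((pos w).1 + (pos w).2) ∧
        s'.mem (A + 1) = 2 * ((pos o).1 - (pos o).2) ∧
        ∀ b, b ≠ A → b ≠ A + 1 → s'.mem b = s.mem b)
      (fun h => ?_) (fun h => ?_)) (fun s7 h7 => Runs.last (.sub _ _ _ _ ?_) ?_))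
  · rw [g617, f619]
    exact abs_le.2 ⟨by linarith, by linarith⟩
  · simp [g617, f619] at h
    refine (runs_writeCorner (by norm_num) (by norm_num) (by norm_num)
      (by simp [k6, h0]) (by simp [k6, h1]) (by simp [k6, h2]) (by simpa using g621)
      (by simpa using g616) (by simpa using g617) (by simpa using f618) hN hW hb (bv p) (bs p)
      (bc p) (bs q)).mono le_rfl ?_
    rintro s' ⟨u1, u2⟩
    refine ⟨fun r hr hr' => by simp [u1 r hr, hr'], p, q, .inl ⟨rfl, rfl⟩, h, ?_⟩
    simpa [e6] using u2
  · simp [g617, f619] at h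
    refine (runs_writeCorner (by norm_num) (by norm_num) (by norm_num)
      (by simp [k6, h0]) (by simp [k6, h1]) (by simp [k6, h2]) (by simpa using g622)
      (by simpa using f618) (by simpa using f619) (by simpa using g616) hN hW hb (bv q) (bs q)
      (bc q) (bs p)).mono le_rfl ?_
    rintro s' ⟨u1, u2⟩
    refine ⟨fun r hr hr' => by simp [u1 r hr, hr'], q, p, .inr ⟨rfl, rfl⟩,
      lt_of_le_of_ne h hcne, ?_⟩
    simpa [e6] using u2
  · obtain ⟨u1, -⟩ := h7
    rw [u1 6 (by norm_num) (by norm_num), u1 1 (by norm_num) (by norm_num), k6 6 (by norm_num),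
      k6 1 (by norm_num), h6, h1]
    have := abs_le.1 b6
    exact abs_le.2 ⟨by linarith, by linarith⟩
  · obtain ⟨u1, u2⟩ := h7
    refine ⟨?_, ?_, ?_, u2⟩
    · rintro r (rfl | rfl | rfl | rfl | rfl) <;>
        simp [u1, k6]
    · simp [u1, g68]
    · simp [u1, k6, h6, h1]

/-- The pairs of vertices that are listed as edges. -/
def Listed {α : Type*} (l : List (α × α)) (u v : α) : Prop := (u, v) ∈ l ∨ (v, u) ∈ l

theorem listed_take_succ {α : Type*} {l : List (α × α)} {i : ℕ} (hi : i < l.length) {w o : α}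
    (hwo : w = l[i].1 ∧ o = l[i].2 ∨ w = l[i].2 ∧ o = l[i].1) (u v : α) :
    Listed (l.take (i + 1)) u v ↔ Listed (l.take i) u v ∨ (u = w ∧ v = o) ∨ (u = o ∧ v = w) := by
  rw [← List.take_append_getElem hi]
  generalize l[i] = e at *
  obtain ⟨p, q⟩ := e
  simp only [Listed, List.mem_append, List.mem_singleton, Prod.mk.injEq]
  rcases hwo with ⟨rfl, rfl⟩ | ⟨rfl, rfl⟩ <;> tauto

/-! ### Effect of one more edge on the extents and on the stored corners. -/

section

variable {V : Type*} {E E' : V → V → Prop} {φ : V → ℤ × ℤ} {d : ℤ × ℤ} {w o : V}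

/-- The new edge also enters as the pair `(o, w)`, but seen from `o` its offset is `-d`, which
positivity of the coordinate sum of `d` separates from `d`. -/
theorem extent_insert_same
    (hE : ∀ u v, E' u v ↔ E u v ∨ (u = w ∧ v = o) ∨ (u = o ∧ v = w)) (hw : φ w = φ o + d)
    (hd : 0 < d.1 + d.2) (v : V) (hv : v ≠ w) : extent E' φ d v = extent E φ d v := by
  unfold extent
  congr 1
  refine propext (exists_congr fun u => ?_)
  rw [hE]
  constructor
  · rintro ⟨h | ⟨rfl, rfl⟩ | ⟨rfl, rfl⟩, h'⟩
    · exact ⟨h, h'⟩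
    · exact absurd rfl hv
    · simp [Prod.ext_iff] at hw h'
      omega
  · exact fun ⟨h, h'⟩ => ⟨.inl h, h'⟩

theorem extent_insert_of_ne {d' : ℤ × ℤ}
    (hE : ∀ u v, E' u v ↔ E u v ∨ (u = w ∧ v = o) ∨ (u = o ∧ v = w)) (hw : φ w = φ o + d)
    (hd : d ≠ d') (hd' : d + d' ≠ 0) (v : V) : extent E' φ d' v = extent E φ d' v := by
  unfold extent
  congr 1
  refine propext (exists_congr fun u => ?_)
  rw [hE]
  constructor
  · rintro ⟨h | ⟨rfl, rfl⟩ | ⟨rfl, rfl⟩, h'⟩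
    · exact ⟨h, h'⟩
    · exact absurd (add_left_cancel (hw.symm.trans h')) hd
    · rw [hw, add_assoc] at h'
      exact absurd (left_eq_add.1 h') hd'
  · exact fun ⟨h, h'⟩ => ⟨.inl h, h'⟩

theorem extent_of_isEmpty (hE : ∀ u v, ¬ E u v) (v : V) : extent E φ d v = 1 :=
  if_neg fun ⟨u, h, _⟩ => hE v u h

end

/-- The new edge sets one extent of `w` to 2 and leaves all others alone; this changes exactly one
corner. If the edge was already listed, the same values are rewritten. All changed cells are
negative, so the input survives. -/
theorem holds_update {n : ℕ} {pos : Fin n → ℤ × ℤ} {E E' : Fin n → Fin n → Prop} {s s' : Config}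
    {w o : Fin n} (hE : ∀ u v, E' u v ↔ E u v ∨ (u = w ∧ v = o) ∨ (u = o ∧ v = w))
    (hadj : squareGrid.Adj (pos w) (pos o)) (hlt : (pos o).1 + (pos o).2 < (pos w).1 + (pos w).2)
    {A : ℤ} (hA : A = -(6 * n) + 6 * (w : ℕ) + 2 -
      2 * (((pos w).1 - (pos w).2) - ((pos o).1 - (pos o).2)))
    (h1 : s'.mem A =
      ((pos o).1 - (pos o).2) * ((pos o).1 - (pos o).2) + ((pos w).1 + (pos w).2))
    (h2 : s'.mem (A + 1) = 2 * ((pos o).1 - (pos o).2))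
    (h3 : ∀ b, b ≠ A → b ≠ A + 1 → s'.mem b = s.mem b)
    (hs : ∀ v, Holds s v (pos v) (extent E pos (1, 0) v) (extent E pos (0, 1) v)) :
    (∀ v, Holds s' v (pos v) (extent E' pos (1, 0) v) (extent E' pos (0, 1) v)) ∧
      ∀ b, 0 ≤ b → s'.mem b = s.mem b := by
  have hEwo : E' w o := (hE w o).2 (.inr (.inl ⟨rfl, rfl⟩))
  have hwn := w.2
  have hcase : pos w = pos o + (1, 0) ∨ pos w = pos o + (0, 1) := by
    rcases squareGrid_adj_cases hadj with h | h | h | h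
    · exact .inl h
    · simp [Prod.ext_iff] at h; omega
    · exact .inr h
    · simp [Prod.ext_iff] at h; omega
  rcases hcase with h | h
  · have e1 : (pos w).1 = (pos o).1 + 1 := by simp [h]
    have e2 : (pos w).2 = (pos o).2 := by simp [h]
    have hA' : A = -(6 * n) + 6 * (w : ℕ) := by rw [hA, e1, e2]; ring
    refine ⟨fun v i j => ?_, fun b hb => h3 b (by omega) (by omega)⟩
    have hi := i.2
    have hj := j.2
    rw [extent_insert_of_ne (d' := (0, 1)) hE h (by decide) (by decide)]
    by_cases hv : v = w
    · subst hv
      rw [extent_eq_two hEwo h]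
      by_cases hi0 : i = 0
      · subst hi0
        rw [e1, e2] at h1
        fin_cases j
        · convert h1 using 2
          · simp [hA']
          · simp [corner, e1, e2]; ring
        · convert h2 using 2
          · simp [hA']
          · simp [corner, e1, e2]; ring
      · have : (i : ℕ) ≠ 0 := fun h => hi0 (Fin.ext h)
        rw [h3 _ (by omega) (by omega), hs v i j]
        fin_cases i
        · exact absurd rfl hi0
        · rfl
        · rfl
    · have hvw : (v : ℕ) ≠ w := fun h => hv (Fin.ext h)
      rw [extent_insert_same hE h (by decide) v hv, h3 _ (by omega) (by omega)]
      exact hs v i j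
  · have e1 : (pos w).1 = (pos o).1 := by simp [h]
    have e2 : (pos w).2 = (pos o).2 + 1 := by simp [h]
    have hA' : A = -(6 * n) + 6 * (w : ℕ) + 4 := by rw [hA, e1, e2]; ring
    refine ⟨fun v i j => ?_, fun b hb => h3 b (by omega) (by omega)⟩
    have hi := i.2
    have hj := j.2
    rw [extent_insert_of_ne (d' := (1, 0)) hE h (by decide) (by decide)]
    by_cases hv : v = w
    · subst hv
      rw [extent_eq_two hEwo h]
      by_cases hi0 : i = 2
      · subst hi0
        rw [e1, e2] at h1
        fin_cases j
        · convert h1 using 2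
          · simp [hA']
          · simp [corner, e1, e2]; ring
        · convert h2 using 2
          · simp [hA']
          · simp [corner, e1, e2]; ring
      · have : (i : ℕ) ≠ 2 := fun h => hi0 (Fin.ext h)
        rw [h3 _ (by omega) (by omega), hs v i j]
        fin_cases i
        · rfl
        · rfl
        · exact absurd rfl hi0
    · have hvw : (v : ℕ) ≠ w := fun h => hv (Fin.ext h)
      rw [extent_insert_same hE h (by decide) v hv, h3 _ (by omega) (by omega)]
      exact hs v i j

/-! ### The two loops and the whole program. -/

section Program

variable {W N : ℤ} {ld : Program} {T d : ℕ} {m₀ : ℤ → ℤ} {n : ℕ} {pos : Fin n → ℤ × ℤ}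
  {es : List (Fin n × Fin n)}

/-- The invariant of the first loop. -/
def VertexInv (d m : ℕ) (m₀ : ℤ → ℤ) {n : ℕ} (pos : Fin n → ℤ × ℤ) (i : ℕ) (s : Config) : Prop :=
  s.reg 0 = -(6 * n) ∧ s.reg 1 = 1 ∧ s.reg 2 = 2 ∧ s.reg 4 = m ∧ s.reg 5 = d ∧ s.reg 9 = 0 ∧
    s.reg 10 = 2 + d * i ∧ s.reg 7 = -(6 * n) + 6 * i ∧ s.reg 6 = n - i ∧
    (∀ b, 0 ≤ b → s.mem b = m₀ b) ∧ ∀ v : Fin n, (v : ℕ) < i → Holds s v (pos v) 1 1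

/-- The invariant of the second loop. -/
def EdgeInv (d : ℕ) (m₀ : ℤ → ℤ) {n : ℕ} (pos : Fin n → ℤ × ℤ) (es : List (Fin n × Fin n)) (i : ℕ)
    (s : Config) : Prop :=
  s.reg 0 = -(6 * n) ∧ s.reg 1 = 1 ∧ s.reg 2 = 2 ∧ s.reg 5 = d ∧ s.reg 9 = 0 ∧
    s.reg 8 = 2 + d * n + 2 * i ∧ s.reg 6 = es.length - i ∧
    (∀ b, 0 ≤ b → s.mem b = m₀ b) ∧
    ∀ v, Holds s v (pos v) (extent (Listed (es.take i)) pos (1, 0) v)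
      (extent (Listed (es.take i)) pos (0, 1) v)

theorem runs_initRegisters {m : ℕ} {s : Config} (hreg : ∀ r, s.reg r = 0) (hn : s.mem 0 = n)
    (hm : s.mem 1 = m) (hN : 1 ≤ N) (hW : 1000 * (N * N) ≤ W) (bn : n ≤ N) (bd : d ≤ 10)
    (hm₀ : s.mem = m₀) : Runs W (initRegisters d) 10 s (VertexInv d m m₀ pos 0) := by
  have bd' : (d : ℤ) ≤ 10 := by exact_mod_cast bd
  have hd0 : (0 : ℤ) ≤ d := by positivity
  have hn0 : (0 : ℤ) ≤ n := by positivity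
  have q2 : N ≤ N * N := by nlinarith
  unfold initRegisters
  refine .step (.const _ _ _ ?_) <| .step (.load _ _ _) <| .step (.load _ _ _) <|
    .step (.const _ _ _ ?_) <| .step (.mul _ _ _ _ ?_) <| .step (.const _ _ _ ?_) <|
    .step (.const _ _ _ ?_) <| .step (.const _ _ _ ?_) <| .step (.add _ _ _ _ ?_) <|
    .last (.add _ _ _ _ ?_) ?_
  case refine_9 =>
    refine ⟨?_, ?_, ?_, ?_, ?_, ?_, ?_, ?_, ?_, ?_, ?_⟩
    any_goals simp [hreg, hn, hm, hm₀]
  all_goals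
    simp [hreg, hn]
    linarith

theorem runs_vertexLoop {m : ℕ} {s : Config} (hld : Loads W ld T d m₀ pos) (hN : 1 ≤ N)
    (hW : 1000 * (N * N) ≤ W) (bpos : ∀ v, |(pos v).1| ≤ 4 * N ∧ |(pos v).2| ≤ 4 * N)
    (bn : n + 2 ≤ N) (bd : d ≤ 8) (hs : VertexInv d m m₀ pos 0 s) :
    Runs W (.loop 6 (.seq ld writeTriangle)) (n * (T + 27) + 1) s (VertexInv d m m₀ pos n) := by
  refine Runs.loop (T := T + 26) _ n ?_ (fun s h => by simp [h.2.2.2.2.2.2.2.2.1]) hs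
  rintro i s hi ⟨h0, h1, h2, h4, h5, h9, h10, h7, h6, hm, hh⟩
  refine ⟨by rw [h6]; omega, Runs.seq (hld s ⟨i, hi⟩ h1 h10 hm) ?_⟩
  rintro s1 ⟨f1m, f11, f12, f1⟩
  have bd' : (d : ℤ) ≤ 8 := by exact_mod_cast bd
  have hd0 : (0 : ℤ) ≤ d := by positivity
  have hi' : (i : ℤ) < n := by exact_mod_cast hi
  have hi0 : (0 : ℤ) ≤ i := by positivity
  have b10 : (d : ℤ) * i ≤ 8 * i := mul_le_mul_of_nonneg_right bd' hi0
  have b10' : 0 ≤ (d : ℤ) * i := mul_nonneg hd0 hi0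
  refine (runs_writeTriangle (d := d) f11 f12 ((f1 7 (by norm_num)).trans h7)
    ((f1 10 (by norm_num)).trans h10) ((f1 6 (by norm_num)).trans h6)
    ((f1 1 (by norm_num)).trans h1) ((f1 5 (by norm_num)).trans h5) hN hW (bpos _).1 (bpos _).2
    (abs_le.2 ⟨by linarith, by linarith⟩) (abs_le.2 ⟨by linarith, by linarith⟩) (by omega)
    (abs_le.2 ⟨by linarith, by linarith⟩)).mono le_rfl ?_
  rintro s2 ⟨f2, f27, f210, f26, f2h, f2m⟩
  refine ⟨?_, ?_, ?_, ?_, ?_, ?_, ?_, ?_, ?_, fun b hb => ?_, fun v hv => ?_⟩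
  · rw [f2 0 (by norm_num), f1 0 (by norm_num), h0]
  · rw [f2 1 (by norm_num), f1 1 (by norm_num), h1]
  · rw [f2 2 (by norm_num), f1 2 (by norm_num), h2]
  · rw [f2 4 (by norm_num), f1 4 (by norm_num), h4]
  · rw [f2 5 (by norm_num), f1 5 (by norm_num), h5]
  · rw [f2 9 (by norm_num), f1 9 (by norm_num), h9]
  · rw [f210]; push_cast; ring
  · rw [f27]; push_cast; ring
  · rw [f26]; push_cast; ring
  · rw [f2m b (.inr (by omega)), f1m, hm b hb]
  · intro k j
    have hk := k.2
    have hj := j.2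
    rcases Nat.lt_succ_iff_lt_or_eq.1 hv with hv | hv
    · rw [f2m _ (.inl (by omega)), f1m]
      exact hh v hv k j
    · obtain rfl : v = ⟨i, hi⟩ := Fin.ext hv
      exact f2h k j

theorem runs_edgeLoop {s : Config} (hld : Loads W ld T d m₀ pos) (hN : 1 ≤ N)
    (hW : 1000 * (N * N) ≤ W) (bpos : ∀ v, |(pos v).1| ≤ 4 * N ∧ |(pos v).2| ≤ 4 * N)
    (bn : n + es.length + 2 ≤ N) (bd : d ≤ 8)
    (hadj : ∀ e ∈ es, squareGrid.Adj (pos e.1) (pos e.2))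
    (hm₀ : ∀ i (hi : i < es.length), m₀ (2 + d * n + 2 * i) = (es[i].1 : ℕ) ∧
      m₀ (2 + d * n + 2 * i + 1) = (es[i].2 : ℕ))
    (hs : EdgeInv d m₀ pos es 0 s) :
    Runs W (.loop 6 (processEdge ld)) (es.length * (2 * T + 31) + 1) s
      (EdgeInv d m₀ pos es es.length) := by
  refine Runs.loop (T := 2 * T + 30) _ es.length ?_ (fun s h => by simp [h.2.2.2.2.2.2.1]) hs
  rintro i s hi ⟨h0, h1, h2, h5, h9, h8, h6, hm, hh⟩
  have bd' : (d : ℤ) ≤ 8 := by exact_mod_cast bd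
  have hd0 : (0 : ℤ) ≤ d := by positivity
  have hi' : (i : ℤ) < es.length := by exact_mod_cast hi
  have hi0 : (0 : ℤ) ≤ i := by positivity
  have hn0 : (0 : ℤ) ≤ n := by positivity
  have b10 : (d : ℤ) * n ≤ 8 * n := mul_le_mul_of_nonneg_right bd' hn0
  have b10' : 0 ≤ (d : ℤ) * n := mul_nonneg hd0 hn0
  have ha := hadj _ (List.getElem_mem hi)
  refine ⟨by rw [h6]; omega, (runs_processEdge hld hN hW bpos (by linarith) (by omega)
    (abs_le.2 ⟨by linarith, by linarith⟩) (by linarith) (abs_le.2 ⟨by linarith, by linarith⟩) ha h0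
    h1 h2 h5 h8 h9 h6 hm (hm₀ i hi).1 (hm₀ i hi).2).mono le_rfl ?_⟩
  rintro s' ⟨f, f8, f6, w, o, hwo, hlt, e1, e2, e3⟩
  have hadj' : squareGrid.Adj (pos w) (pos o) := by
    rcases hwo with ⟨rfl, rfl⟩ | ⟨rfl, rfl⟩
    · exact ha
    · exact ha.symm
  obtain ⟨g1, g2⟩ := holds_update (listed_take_succ hi hwo) hadj' hlt rfl e1 e2 e3 hh
  refine ⟨?_, ?_, ?_, ?_, ?_, ?_, ?_, fun b hb => ?_, g1⟩
  · rw [f 0 (by norm_num), h0]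
  · rw [f 1 (by norm_num), h1]
  · rw [f 2 (by norm_num), h2]
  · rw [f 5 (by norm_num), h5]
  · rw [f 9 (by norm_num), h9]
  · rw [f8]; push_cast; ring
  · rw [f6]; push_cast; ring
  · rw [g2 b hb, hm b hb]

theorem runs_gridProgram {s : Config} (hld : Loads W ld T d m₀ pos) (hN : 1 ≤ N)
    (hW : 1000 * (N * N) ≤ W) (bpos : ∀ v, |(pos v).1| ≤ 4 * N ∧ |(pos v).2| ≤ 4 * N)
    (bn : n + es.length + 2 ≤ N) (bd : d ≤ 8)
    (hadj : ∀ e ∈ es, squareGrid.Adj (pos e.1) (pos e.2))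
    (hm₀ : ∀ i (hi : i < es.length), m₀ (2 + d * n + 2 * i) = (es[i].1 : ℕ) ∧
      m₀ (2 + d * n + 2 * i + 1) = (es[i].2 : ℕ))
    (hreg : ∀ r, s.reg r = 0) (hn : s.mem 0 = n) (hm : s.mem 1 = es.length) (hs : s.mem = m₀) :
    Runs W (gridProgram ld d) ((2 * T + 40) * (n + es.length + 1)) s fun s' =>
      s'.reg 0 = -(6 * n) ∧ ∀ v, Holds s' v (pos v) (extent (Listed es) pos (1, 0) v)
        (extent (Listed es) pos (0, 1) v) := by
  have bd' : (d : ℤ) ≤ 8 := by exact_mod_cast bd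
  have hd0 : (0 : ℤ) ≤ d := by positivity
  have hn0 : (0 : ℤ) ≤ n := by positivity
  have b10 : (d : ℤ) * n ≤ 8 * n := mul_le_mul_of_nonneg_right bd' hn0
  have b10' : 0 ≤ (d : ℤ) * n := mul_nonneg hd0 hn0
  have q2 : N ≤ N * N := by nlinarith
  unfold gridProgram
  refine Runs.mono (T := 10 + ((n * (T + 27) + 1) + (es.length * (2 * T + 31) + 1 + 1 + 1)))
    (Runs.seq (runs_initRegisters (pos := pos) hreg hn hm hN hW (by linarith) (by omega) hs)
    fun s1 h1 => Runs.seq (runs_vertexLoop hld hN hW bpos (by linarith) bd h1) fun s2 h2 => ?_)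
    (by nlinarith) (fun s' h => ⟨h.1, by simpa using h.2.2.2.2.2.2.2.2⟩)
    (P := EdgeInv d m₀ pos es es.length)
  obtain ⟨h0, h1, h2, h4, h5, h9, h10, h7, h6, hm, hh⟩ := h2
  -- Register 10 has passed all vertex records, so it points to the first edge.
  refine .step (.add _ _ _ _ ?_) <| .step (.add _ _ _ _ ?_) <|
    runs_edgeLoop hld hN hW bpos bn bd hadj hm₀ ?_
  · rw [h10, h9]
    exact abs_le.2 ⟨by linarith, by linarith⟩
  · simp [h4, h9]
    linarith
  · refine ⟨?_, ?_, ?_, ?_, ?_, ?_, ?_, ?_, fun v => ?_⟩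
    · simp [h0]
    · simp [h1]
    · simp [h2]
    · simp [h5]
    · simp [h9]
    · simp [h9, h10]
    · simp [h4, h9]
    · simpa using hm
    -- With no edge processed all extents are 1, which is what the first loop wrote.
    · rw [extent_of_isEmpty (by simp [Listed]), extent_of_isEmpty (by simp [Listed])]
      exact hh v v.2

end Program

/-! ### Reading the input -/

theorem startConfig_mem (l : List ℤ) (k : ℕ) : (startConfig l).mem k = l.getD k 0 := by
  simp [startConfig]

theorem length_flatten_of_forall {α : Type*} {d : ℕ} (l : List (List α))
    (h : ∀ x ∈ l, x.length = d) : l.flatten.length = d * l.length := by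
  induction l with
  | nil => simp
  | cons x l ih =>
    rw [List.flatten_cons, List.length_append, ih fun y hy => h y (.tail _ hy), h x (.head _),
      List.length_cons]
    ring

theorem getD_flatten_of_forall {α : Type*} {d : ℕ} (l : List (List α)) (z : α)
    (h : ∀ x ∈ l, x.length = d) (i : ℕ) (hi : i < l.length) (j : ℕ) (hj : j < d) :
    l.flatten.getD (d * i + j) z = l[i].getD j z := by
  induction l generalizing i with
  | nil => simp at hi
  | cons x l ih =>
    have hx := h x (.head _)
    rw [List.flatten_cons]
    cases i with
    | zero => rw [List.getD_append _ _ _ _ (by simp [hx, hj])]; simp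
    | succ i =>
      rw [List.getD_append_right _ _ _ _ (by rw [hx, mul_add]; omega), hx,
        show d * (i + 1) + j - d = d * i + j by rw [mul_add]; omega,
        ih (fun y hy => h y (.tail _ hy)) i (by simpa using hi)]
      simp

theorem inputWords_mem_zero {P : Type*} (code : P → List ℤ) {n : ℕ} (pos : Fin n → P)
    (es : List (Fin n × Fin n)) : (startConfig (inputWords code pos es)).mem 0 = n := by
  have := startConfig_mem (inputWords code pos es) 0
  simpa [inputWords] using this

theorem inputWords_mem_one {P : Type*} (code : P → List ℤ) {n : ℕ} (pos : Fin n → P)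
    (es : List (Fin n × Fin n)) : (startConfig (inputWords code pos es)).mem 1 = es.length := by
  have := startConfig_mem (inputWords code pos es) 1
  simpa [inputWords] using this

theorem length_vertexWords {P : Type*} {code : P → List ℤ} {d n : ℕ}
    (hcode : ∀ p, (code p).length = d) (pos : Fin n → P) :
    (List.ofFn fun v => code (pos v)).flatten.length = d * n := by
  rw [length_flatten_of_forall (d := d) _ (by simp [List.mem_ofFn, hcode]), List.length_ofFn]

theorem length_edgeWords {n : ℕ} (es : List (Fin n × Fin n)) :
    (es.flatMap fun e => [((e.1 : ℕ) : ℤ), ((e.2 : ℕ) : ℤ)]).length = 2 * es.length := by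
  rw [List.flatMap_def, length_flatten_of_forall (d := 2) _ (by rintro x hx; obtain ⟨e, -, rfl⟩ := List.mem_map.1 hx; rfl), List.length_map]

theorem length_inputWords {P : Type*} {code : P → List ℤ} {d n : ℕ}
    (hcode : ∀ p, (code p).length = d) (pos : Fin n → P) (es : List (Fin n × Fin n)) :
    (inputWords code pos es).length = 2 + d * n + 2 * es.length := by
  rw [inputWords, List.length_append, List.length_append, length_vertexWords hcode,
    length_edgeWords]
  rfl

theorem inputWords_mem_vertex {P : Type*} {code : P → List ℤ} {d n : ℕ}
    (hcode : ∀ p, (code p).length = d) (pos : Fin n → P) (es : List (Fin n × Fin n)) (v : Fin n)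
    (j : ℕ) (hj : j < d) :
    (startConfig (inputWords code pos es)).mem (2 + d * (v : ℕ) + j) = (code (pos v)).getD j 0 := by
  have h := startConfig_mem (inputWords code pos es) (2 + (d * v + j))
  have hlt : d * (v : ℕ) + j < d * n := by
    have := Nat.mul_le_mul_left d (Nat.succ_le_of_lt v.2)
    rw [Nat.mul_succ] at this
    omega
  rw [inputWords, List.append_assoc, List.getD_append_right _ _ _ _ (by simp),
    List.getD_append _ _ _ _ (by rw [length_vertexWords hcode]; simp; omega)] at h
  simp only [List.length_cons, List.length_nil, zero_add, Nat.reduceAdd, add_tsub_cancel_left] at h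
  rw [getD_flatten_of_forall (d := d) _ _ (by simp [List.mem_ofFn, hcode]) v (by simp) j hj] at h
  rw [List.getElem_ofFn] at h
  rw [← h, inputWords, List.append_assoc]
  congr 1
  push_cast
  ring

theorem inputWords_mem_edge {P : Type*} {code : P → List ℤ} {d n : ℕ}
    (hcode : ∀ p, (code p).length = d) (pos : Fin n → P) (es : List (Fin n × Fin n)) (i : ℕ)
    (hi : i < es.length) (j : ℕ) (hj : j < 2) :
    (startConfig (inputWords code pos es)).mem (2 + d * n + 2 * i + j) =
      [((es[i].1 : ℕ) : ℤ), ((es[i].2 : ℕ) : ℤ)].getD j 0 := by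
  have h := startConfig_mem (inputWords code pos es) (2 + d * n + (2 * i + j))
  have hl : ([(n : ℤ), (es.length : ℤ)] ++ (List.ofFn fun v => code (pos v)).flatten).length =
      2 + d * n := by
    rw [List.length_append, length_vertexWords hcode]
    rfl
  rw [inputWords, List.getD_append_right _ _ _ _ (by rw [hl]; omega), hl, Nat.add_sub_cancel_left,
    List.flatMap_def, getD_flatten_of_forall (d := 2) _ _ (by rintro x hx; obtain ⟨e, -, rfl⟩ := List.mem_map.1 hx; rfl) i (by simpa using hi) j hj,
    List.getElem_map] at h
  rw [← h, inputWords, List.flatMap_def]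
  congr 1
  push_cast
  ring

/-! ### Linear time -/

/-- Only the loader depends on the grid: it must deliver square-grid coordinates in constant time,
and these must be at most four times the bound on the input words. -/
theorem ttRepInLinearTime_of_loads {P : Type*} {L : SimpleGraph P} {code : P → List ℤ} {d : ℕ}
    (ι : SimpleGraph.Copy L squareGrid) (hd1 : 1 ≤ d) (hd : d ≤ 8)
    (hcode : ∀ p, (code p).length = d) (ld : Program) (T : ℕ)
    (hld : ∀ (n : ℕ) (N W : ℤ) (m₀ : ℤ → ℤ) (pos : Fin n → P), n + 2 ≤ N → 1000 * (N * N) ≤ W →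
      (∀ v, ∀ w ∈ code (pos v), |w| ≤ N) →
      (∀ (v : Fin n) (j : ℕ), j < d → m₀ (2 + d * (v : ℕ) + j) = (code (pos v)).getD j 0) →
      Loads W ld T d m₀ (fun v => ι (pos v)))
    (hb : ∀ p (N : ℤ), 1 ≤ N → (∀ w ∈ code p, |w| ≤ N) →
      |(ι p).1| ≤ 4 * N ∧ |(ι p).2| ≤ 4 * N) :
    TTRepInLinearTime L code := by
  refine ⟨gridProgram ld d, 2 * T + 40, 7, fun n G φ es hes M hM hw => ?_⟩
  rw [length_inputWords hcode] at hM
  have hdn : n ≤ d * n := Nat.le_mul_of_pos_left n hd1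
  have hM' : (n : ℤ) + es.length + 2 ≤ (M : ℤ) + 2 := by omega
  have hN : (1 : ℤ) ≤ (M : ℤ) + 2 := by omega
  -- The two header words force `M ≥ 2`; then `1000 ≤ 4 ^ 5 ≤ (M + 2) ^ 5`, hence the exponent 7.
  have hN4 : (4 : ℤ) ≤ (M : ℤ) + 2 := by omega
  have hW : 1000 * (((M : ℤ) + 2) * (M + 2)) ≤ ((M : ℤ) + 2) ^ 7 := by
    have h5 : (4 : ℤ) ^ 5 ≤ ((M : ℤ) + 2) ^ 5 := pow_le_pow_left₀ (by norm_num) hN4 5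
    have h2 : 0 ≤ ((M : ℤ) + 2) * (M + 2) := mul_self_nonneg _
    calc 1000 * (((M : ℤ) + 2) * (M + 2)) ≤ ((M : ℤ) + 2) ^ 5 * (((M : ℤ) + 2) * (M + 2)) :=
          mul_le_mul_of_nonneg_right (by linarith) h2
      _ = ((M : ℤ) + 2) ^ 7 := by ring
  have hcw : ∀ v, ∀ w ∈ code (φ v), |w| ≤ (M : ℤ) + 2 := by
    intro v w hwv
    refine (hw w ?_).trans (by linarith)
    simp only [inputWords, List.mem_append, List.mem_flatten, List.mem_ofFn]
    exact .inl (.inr ⟨_, ⟨v, rfl⟩, hwv⟩)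
  obtain ⟨t, s, hexec, ht, h0, hholds⟩ := runs_gridProgram (es := es) (d := d)
    (s := startConfig (inputWords code φ es))
    (hld n (M + 2) _ (startConfig (inputWords code φ es)).mem φ (by linarith) hW hcw
      (inputWords_mem_vertex hcode φ es)) hN hW (fun v => hb _ _ hN (hcw v)) hM' hd
    (fun e he => ι.toHom.map_adj (φ.toHom.map_adj ((hes e.1 e.2).2 (.inl he))))
    (fun i hi => ⟨by simpa using inputWords_mem_edge hcode φ es i hi 0 (by norm_num),
      by simpa using inputWords_mem_edge hcode φ es i hi 1 (by norm_num)⟩)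
    (fun _ => rfl) (inputWords_mem_zero code φ es) (inputWords_mem_one code φ es) rfl
  refine ⟨t, s, gridTri G.Adj (ι.comp φ), hexec, ht, fun v i j => ?_, isTTRep_gridTri _⟩
  have hE : G.Adj = Listed es := by
    ext u v
    exact hes u v
  rw [h0, hholds v i j, hE]
  exact cornerPoint_apply _ _ _ _ i j

/-! ### The loaders of the two grids. -/

def loadSquare : Program := .seq (.load 11 10) <| .seq (.add 13 10 1) <| .load 12 13

/-- Computes the brick-wall coordinates `(2a + b + t, b)` while reading `(a, b, t)`. -/
def loadHex : Program :=
  .seq (.load 11 10) <| .seq (.add 11 11 11) <| .seq (.add 13 10 1) <| .seq (.load 12 13) <|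
  .seq (.add 11 11 12) <| .seq (.add 13 13 1) <| .seq (.load 14 13) <| .add 11 11 14

theorem ttRepInLinearTime_squareGrid : TTRepInLinearTime squareGrid squareCode := by
  refine ttRepInLinearTime_of_loads (d := 2) (SimpleGraph.Copy.id squareGrid) (by norm_num)
    (by norm_num) (fun _ => rfl) loadSquare 3 ?_ ?_
  · intro n N W m₀ pos hn hW hN hm s v h1 h10 hs
    have q2 : N ≤ N * N := by nlinarith
    have hv : ((v : ℕ) : ℤ) < n := by exact_mod_cast v.2
    have hv0 : (0 : ℤ) ≤ (v : ℕ) := by positivity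
    have m0 := hm v 0 (by norm_num)
    have m1 := hm v 1 (by norm_num)
    simp [squareCode] at m0 m1 h10
    unfold loadSquare
    refine .step (.load _ _ _) <| .step (.add _ _ _ _ ?_) <| .last (.load _ _ _) ?_
    · simp [h1, h10]
      exact abs_le.2 ⟨by linarith, by linarith⟩
    · refine ⟨rfl, ?_, ?_, fun r hr => ?_⟩
      · simp [h10]
        rw [hs _ (by omega), m0]
      · simp [h10, h1]
        rw [hs _ (by omega), m1]
      · simp [show r ≠ 11 by omega, show r ≠ 12 by omega, show r ≠ 13 by omega]
  · intro p N hN h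
    simp [squareCode] at h
    exact ⟨h.1.trans (by linarith), h.2.trans (by linarith)⟩

theorem ttRepInLinearTime_hexGrid : TTRepInLinearTime hexGrid hexCode := by
  refine ttRepInLinearTime_of_loads (d := 3) hexToSquare (by norm_num)
    (by norm_num) (fun _ => rfl) loadHex 8 ?_ ?_
  · intro n N W m₀ pos hn hW hN hm s v h1 h10 hs
    have q2 : N ≤ N * N := by nlinarith
    have hv : ((v : ℕ) : ℤ) < n := by exact_mod_cast v.2
    have hv0 : (0 : ℤ) ≤ (v : ℕ) := by positivity
    have m0 := hm v 0 (by norm_num)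
    have m1 := hm v 1 (by norm_num)
    have m2 := hm v 2 (by norm_num)
    have hN' := hN v
    simp [hexCode] at m0 m1 m2 h10 hN'
    have e0 : s.mem (2 + 3 * (v : ℕ)) = (pos v).1 := by rw [hs _ (by omega), m0]
    have e1 : s.mem (2 + 3 * (v : ℕ) + 1) = (pos v).2.1 := by rw [hs _ (by omega), m1]
    have e2 : s.mem (2 + 3 * (v : ℕ) + 1 + 1) = if (pos v).2.2 then 1 else 0 := by
      rw [hs _ (by omega), ← m2]
      congr 1
    have b0 := abs_le.1 hN'.1
    have b1 := abs_le.1 hN'.2.1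
    have b2 : (0 : ℤ) ≤ (if (pos v).2.2 then 1 else 0) ∧
        (if (pos v).2.2 then 1 else 0) ≤ (1 : ℤ) := by split_ifs <;> norm_num
    have e3 : (hexToSquare (pos v)).1 =
        2 * (pos v).1 + (pos v).2.1 + if (pos v).2.2 then 1 else 0 := rfl
    generalize (if (pos v).2.2 then (1 : ℤ) else 0) = z at e2 e3 b2
    unfold loadHex
    refine .step (.load _ _ _) <| .step (.add _ _ _ _ ?_) <| .step (.add _ _ _ _ ?_) <|
      .step (.load _ _ _) <| .step (.add _ _ _ _ ?_) <| .step (.add _ _ _ _ ?_) <|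
      .step (.load _ _ _) <| .last (.add _ _ _ _ ?_) ?_
    case refine_6 =>
      refine ⟨rfl, ?_, ?_, fun r hr => ?_⟩
      · simp [h10, h1, e0, e1, e2]
        rw [e3]
        ring
      · simp [h10, h1, e1]
        rfl
      · simp [show r ≠ 11 by omega, show r ≠ 12 by omega, show r ≠ 13 by omega,
          show r ≠ 14 by omega]
    all_goals
      simp [h10, h1, e0, e1, e2]
      exact abs_le.2 ⟨by linarith, by linarith⟩
  -- `|2a + b + t| ≤ 3N + 1 ≤ 4N`: this is where the factor 4 comes from.
  · intro p N hN h
    simp [hexCode] at h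
    obtain ⟨h0, h1, -⟩ := h
    rw [abs_le] at h0 h1
    have b2 : (0 : ℤ) ≤ (if p.2.2 then 1 else 0) ∧
        (if p.2.2 then 1 else 0) ≤ (1 : ℤ) := by split_ifs <;> norm_num
    refine ⟨abs_le.2 ?_, abs_le.2 ?_⟩
    · change _ ≤ 2 * p.1 + p.2.1 + (if p.2.2 then 1 else 0) ∧
        2 * p.1 + p.2.1 + (if p.2.2 then 1 else 0) ≤ _
      constructor <;> linarith
    · change _ ≤ p.2.1 ∧ p.2.1 ≤ _
      constructor <;> linarith

end TouchingTriangles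

theorem mainTheorem2 :
    (∀ (V : Type*) [Finite V] (G : SimpleGraph V),
      G.IsContained TouchingTriangles.squareGrid ∨ G.IsContained TouchingTriangles.hexGrid →
        ∃ T : V → Affine.Triangle ℝ TouchingTriangles.Plane, TouchingTriangles.IsTTRep G T) ∧
    TouchingTriangles.TTRepInLinearTime TouchingTriangles.squareGrid
      TouchingTriangles.squareCode ∧
    TouchingTriangles.TTRepInLinearTime TouchingTriangles.hexGrid
      TouchingTriangles.hexCode :=
  ⟨fun _ _ G h => TouchingTriangles.exists_isTTRep G h,
    TouchingTriangles.ttRepInLinearTime_squareGrid, TouchingTriangles.ttRepInLinearTime_hexGrid⟩
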